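/- Let $N\ge 2$ be an integer and $\alpha\in(0,2)$. Write points of $\mathbb R^{2N}$ as $(\mathbf x_1,\dots,\mathbf x_N)$ with $\mathbf x_j\in\mathbb R^2$, put $(x,y)^\perp=(-y,x)$, and for $1\le j\le N$ let $$D_j=-\mathrm i\nabla_{\mathbf x_j}+\alpha\mathbf A_j,\qquad \mathbf A_j=\sum_{k\ne j}\frac{(\mathbf x_j-\mathbf x_k)^\perp}{|\mathbf x_j-\mathbf x_k|^2},$$ acting in the sense of distributions on $\mathbb R^{2N}\setminus\{\mathbf x_j=\mathbf x_l\text{ for some }j\ne l\}$. Let $$C_\alpha=2\min_{q\in\mathbb Z}|\alpha-2q|^2 .$$ Let $\phi\in L^2(\mathbb R^{2N};\mathbb C)$ be symmetric under all permutations of $\mathbf x_1,\dots,\mathbf x_N$, and suppose that $D_j\phi\in L^2(\mathbb R^{2N};\mathbb C^2)$ for every $j$. Then $\int_{\mathbb R^{2N}}|\phi|^2/|\mathbf x_j-\mathbf x_l|^2<\infty$ for all $j<l$, and $$\sum_{k=1}^N\int_{\mathbb R^{2N}}|D_k\phi|^2\;\ge\;\frac{2C_\alpha}{(N-1)\bigl(2+3(N-2)C_\alpha\bigr)}\sum_{1\le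 j<l\le N}\int_{\mathbb R^{2N}}\frac{|\phi|^2}{|\mathbf x_j-\mathbf x_l|^2}.$$ -/

import Mathlib

open MeasureTheory
open scoped ContDiff

noncomputable section

namespace Anyon

/-- The Euclidean plane `ℝ²`. -/
abbrev Plane : Type := EuclideanSpace ℝ (Fin 2)

/-- The configuration space `ℝ^{2N} = (ℝ²)^N` of `N` particles in the plane. Its `volume` is
Lebesgue measure; the norm of this type is never used for anything but its topology. -/
abbrev Config (N : ℕ) : Type := Fin N → Plane

/-- `𝐱^⊥ = (-y, x)` for `𝐱 = (x, y)`. -/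
def perp (v : Plane) : Plane := !₂[-v 1, v 0]

/-- The diagonals: configurations in which two different particles sit at the same point. -/
def diagonals (N : ℕ) : Set (Config N) := {x | ∃ j l, j ≠ l ∧ x j = x l}

/-- The vector potential `𝐀_j = ∑_{k ≠ j} (𝐱_j - 𝐱_k)^⊥ / |𝐱_j - 𝐱_k|²`, a function of the whole
configuration. -/
def vectorPotential {N : ℕ} (j : Fin N) (x : Config N) : Plane :=
  ∑ k ∈ Finset.univ.erase j, (‖x j - x k‖ ^ 2)⁻¹ • perp (x j - x k)

/-- The classical partial derivative of `ψ` with respect to the `a`-th coordinate of particle `j`. -/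
def partialDeriv {N : ℕ} (j : Fin N) (a : Fin 2) (ψ : Config N → ℂ) (x : Config N) : ℂ :=
  fderiv ℝ ψ x (Pi.single j (EuclideanSpace.single a 1))

/-- Complex-valued test functions in `C_c^∞(ℝ^{2N} ∖ diagonals)`. -/
structure IsTestFunction {N : ℕ} (ψ : Config N → ℂ) : Prop where
  smooth : ContDiff ℝ ∞ ψ
  compact : HasCompactSupport ψ
  support : tsupport ψ ⊆ (diagonals N)ᶜ

/-- `G = D_j φ`, where `D_j = -i ∇_{𝐱_j} + α 𝐀_j`, in the sense of distributions on
`ℝ^{2N} ∖ diagonals` (`𝐀_j` is smooth there). Since the diagonals are a null set, `G` is determined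
by `φ` almost everywhere. -/
def IsMagneticDeriv {N : ℕ} (α : ℝ) (j : Fin N) (φ : Config N → ℂ)
    (G : Config N → EuclideanSpace ℂ (Fin 2)) : Prop :=
  ∀ ψ : Config N → ℂ, IsTestFunction ψ → ∀ a : Fin 2,
    ∫ x, G x a * ψ x =
      ∫ x, φ x * (Complex.I * partialDeriv j a ψ x + ((α * vectorPotential j x a : ℝ) : ℂ) * ψ x)

/-- `φ ∈ L²_sym(ℝ^{2N})`: square integrable and, almost everywhere, invariant under every
permutation of the particles. -/
structure IsSymmetricL2 {N : ℕ} (φ : Config N → ℂ) : Prop where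
  memLp : MemLp φ 2 volume
  symm : ∀ σ : Equiv.Perm (Fin N), (fun x : Config N => φ (x ∘ σ)) =ᵐ[volume] φ

/-- `C_α = 2 min_{q ∈ ℤ} |α - 2q|²`. The infimum is over a set bounded below and is attained. -/
def hardyConst (α : ℝ) : ℝ := 2 * ⨅ q : ℤ, |α - 2 * (q : ℝ)| ^ 2

end Anyon

end

/-!
Fix a pair `j ≠ l`. Where no other particle lies in the closed disc with diameter `[x j, x l]`, the
other particles contribute only a gradient to the vector potential along the rotation of the pair
about its midpoint, and this gradient is gauged away. The half-turn exchanges the two bosons, so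
the only energies of `φ` along each circle of rotation are `|α - 2 q| ^ 2` with `q ∈ ℤ`; this gives
a Hardy inequality with the constant `hardyConst α`. Where some particle `k` does lie in that disc,
it sees `x j` and `x l` under a non-acute angle, so that
`‖x j - x k‖ ^ 2 + ‖x l - x k‖ ^ 2 ≤ ‖x j - x l‖ ^ 2`. Along the dilation of `x j` and `x l` about
`x k` the vector potential is a pure gauge, and the resulting radial Hardy inequality has constant
`1`. Summing over `k` bounds the integral for the pair by
`(hardyConst α)⁻¹ + (N - 2)` times the kinetic energy of the particles `j` and `l`.
-/

namespace Anyon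

section Bump

variable {E : Type*} [NormedAddCommGroup E] [NormedSpace ℝ E]

/-- Complex test functions `C_c^∞(U)`. -/
structure IsBump (U : Set E) (ψ : E → ℂ) : Prop where
  smooth : ContDiff ℝ ∞ ψ
  compact : HasCompactSupport ψ
  support : tsupport ψ ⊆ U

namespace IsBump

variable {U : Set E} {ψ ψ' : E → ℂ}

theorem eq_zero_of_notMem (hψ : IsBump U ψ) {x : E} (hx : x ∉ U) : ψ x = 0 :=
  image_eq_zero_of_notMem_tsupport fun h => hx (hψ.support h)

theorem mul_left (hU : IsOpen U) (hψ : IsBump U ψ) {g : E → ℂ} (hg : ContDiffOn ℝ ∞ g U) :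
    IsBump U (fun x => g x * ψ x) := by
  refine ⟨contDiff_iff_contDiffAt.2 fun x => ?_, hψ.compact.mul_left,
    tsupport_mul_subset_right.trans hψ.support⟩
  by_cases hx : x ∈ tsupport ψ
  · exact ((hg x (hψ.support hx)).contDiffAt (hU.mem_nhds (hψ.support hx))).mul
      hψ.smooth.contDiffAt
  · refine (contDiffAt_const (c := (0 : ℂ))).congr_of_eventuallyEq ?_
    filter_upwards [notMem_tsupport_iff_eventuallyEq.1 hx] with y hy
    simp [hy]

theorem const_mul (hψ : IsBump U ψ) (c : ℂ) : IsBump U (fun x => c * ψ x) :=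
  ⟨contDiff_const.mul hψ.smooth, hψ.compact.mul_left,
    tsupport_mul_subset_right.trans hψ.support⟩

theorem add (hψ : IsBump U ψ) (hψ' : IsBump U ψ') : IsBump U (fun x => ψ x + ψ' x) :=
  ⟨hψ.smooth.add hψ'.smooth, hψ.compact.add hψ'.compact,
    (tsupport_add ψ ψ').trans (Set.union_subset hψ.support hψ'.support)⟩

theorem fderiv_apply (hψ : IsBump U ψ) {V : E → E} (hV : ContDiff ℝ ∞ V) :
    IsBump U (fun x => fderiv ℝ ψ x (V x)) := by
  have hzero : ∀ x ∉ tsupport ψ, fderiv ℝ ψ x (V x) = 0 := fun x hx => by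
    rw [image_eq_zero_of_notMem_tsupport fun h => hx (tsupport_fderiv_subset ℝ h),
      zero_apply]
  refine ⟨(hψ.smooth.fderiv_right (m := ∞) (by exact_mod_cast le_top)).clm_apply hV,
    HasCompactSupport.intro hψ.compact hzero, ?_⟩
  refine (closure_minimal (fun x hx => ?_) (isClosed_tsupport ψ)).trans hψ.support
  by_contra h
  exact hx (hzero x h)

variable [MeasurableSpace E] [BorelSpace E] {μ : Measure E}

theorem integrable_mul (hψ : IsBump U ψ) {f : E → ℂ}
    (hf : LocallyIntegrable f μ) : Integrable (fun x => f x * ψ x) μ := by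
  simpa only [mul_comm, smul_eq_mul] using
    hf.integrable_smul_left_of_hasCompactSupport hψ.smooth.continuous hψ.compact

variable [IsFiniteMeasureOnCompacts μ]

theorem memLp (hψ : IsBump U ψ) : MemLp ψ 2 μ :=
  hψ.smooth.continuous.memLp_of_hasCompactSupport hψ.compact

theorem integrable_norm_sq (hψ : IsBump U ψ) : Integrable (fun x => ‖ψ x‖ ^ 2) μ :=
  (memLp_two_iff_integrable_sq_norm hψ.memLp.1).1 hψ.memLp

end IsBump

theorem exists_contDiff_cutoff [FiniteDimensional ℝ E] {K U : Set E} (hK : IsCompact K)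
    (hU : IsOpen U) (hKU : K ⊆ U) :
    ∃ χ : E → ℝ, IsBump U (fun x => (χ x : ℂ)) ∧ (∀ x ∈ K, χ x = 1) ∧
      ∀ x, χ x ∈ Set.Icc 0 1 := by
  obtain ⟨K', hK', hKK', hK'U⟩ := exists_compact_between hK hU hKU
  obtain ⟨χ, hχ0, hχ1, hχ⟩ := exists_contMDiffMap_zero_one_of_isClosed (n := ⊤)
    (modelWithCornersSelf ℝ E) (s := (interior K')ᶜ) (t := K) isOpen_interior.isClosed_compl
    hK.isClosed (Set.disjoint_left.2 fun x hx hx' => hx (hKK' hx'))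
  have hsupport : tsupport (fun x => (χ x : ℂ)) ⊆ K' := by
    refine closure_minimal (fun x hx => ?_) hK'.isClosed
    by_contra hxK
    exact hx (by simp only [hχ0 fun h => hxK (interior_subset h), Pi.zero_apply,
      Complex.ofReal_zero])
  exact ⟨χ, ⟨Complex.ofRealCLM.contDiff.comp χ.contMDiff.contDiff,
    HasCompactSupport.of_support_subset_isCompact hK' ((subset_tsupport _).trans hsupport),
    hsupport.trans hK'U⟩, fun x hx => hχ1 hx, hχ⟩

theorem exists_isBump_norm_sq_eq_inv [FiniteDimensional ℝ E] {K U : Set E} (hK : IsCompact K)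
    (hU : IsOpen U) (hKU : K ⊆ U) {W : E → ℝ} (hW : ContDiff ℝ ∞ W) (hWpos : ∀ x ∈ U, 0 < W x) :
    ∃ κ, IsBump U κ ∧ (∀ x ∈ K, ‖κ x‖ ^ 2 = (W x)⁻¹) ∧ ∀ x, W x * ‖κ x‖ ^ 2 ∈ Set.Icc 0 1 := by
  obtain ⟨χ, hχ, hχ_one, hχ_mem⟩ := exists_contDiff_cutoff hK hU hKU
  have hκ : IsBump U fun x => ((√(W x))⁻¹ : ℝ) * (χ x : ℂ) :=
    hχ.mul_left hU <| Complex.ofRealCLM.contDiff.comp_contDiffOn <|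
      (hW.contDiffOn.sqrt fun x hx => (hWpos x hx).ne').inv fun x hx =>
        (Real.sqrt_pos.2 (hWpos x hx)).ne'
  have hκ_sq (x : E) (hx : x ∈ U) : ‖((√(W x))⁻¹ : ℝ) * (χ x : ℂ)‖ ^ 2 = (W x)⁻¹ * χ x ^ 2 := by
    rw [norm_mul, Complex.norm_real, Complex.norm_real, mul_pow, Real.norm_eq_abs,
      Real.norm_eq_abs, sq_abs, sq_abs, inv_pow, Real.sq_sqrt (hWpos x hx).le]
  refine ⟨_, hκ, fun x hx => by rw [hκ_sq x (hKU hx), hχ_one x hx, one_pow, mul_one],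
    fun x => ?_⟩
  by_cases hx : x ∈ U
  · rw [hκ_sq x hx, mul_inv_cancel_left₀ (hWpos x hx).ne']
    exact ⟨sq_nonneg _, pow_le_one₀ (hχ_mem x).1 (hχ_mem x).2⟩
  · have hκx : ((√(W x))⁻¹ : ℝ) * (χ x : ℂ) = 0 := hκ.eq_zero_of_notMem hx
    rw [hκx, norm_zero, zero_pow two_ne_zero, mul_zero]
    exact ⟨le_rfl, zero_le_one⟩

end Bump

section Duality

theorem norm_toLp_sq {X : Type*} [MeasurableSpace X] {ν : Measure X} {u : X → ℂ}
    (hu : MemLp u 2 ν) : ‖hu.toLp‖ ^ 2 = ∫ x, ‖u x‖ ^ 2 ∂ν := by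
  have h : inner ℂ hu.toLp hu.toLp = ((∫ x, ‖u x‖ ^ 2 ∂ν : ℝ) : ℂ) := by
    rw [L2.inner_def, ← integral_complex_ofReal]
    refine integral_congr_ae ?_
    filter_upwards [hu.coeFn_toLp] with x hx
    rw [hx, inner_self_eq_norm_sq_to_K]
    norm_cast
  rw [← @inner_self_eq_norm_sq ℂ, h]
  exact Complex.ofReal_re _

variable {E : Type*} [NormedAddCommGroup E] [NormedSpace ℝ E] [FiniteDimensional ℝ E]
  [MeasurableSpace E] [BorelSpace E] {μ : Measure E} [IsFiniteMeasureOnCompacts μ]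

theorem norm_inner_sq_le_of_pairing_le {f : E → ℂ} (hf : MemLp (fun x => star (f x)) 2 μ) {M : ℝ}
    (h : ∀ ψ, IsBump Set.univ ψ → ‖∫ x, f x * ψ x ∂μ‖ ^ 2 ≤ M * ∫ x, ‖ψ x‖ ^ 2 ∂μ)
    (u : Lp ℂ 2 μ) : ‖inner ℂ hf.toLp u‖ ^ 2 ≤ M * ‖u‖ ^ 2 := by
  have hclosed : IsClosed {u : Lp ℂ 2 μ | ‖inner ℂ hf.toLp u‖ ^ 2 ≤ M * ‖u‖ ^ 2} :=
    isClosed_le (by fun_prop) (by fun_prop)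
  have hdense := Lp.dense_hasCompactSupport_contDiff (μ := μ) (F := ℂ) (p := 2) (by simp)
  refine closure_minimal ?_ hclosed (hdense u)
  rintro v ⟨ψ, hvψ, hψc, hψs⟩
  have hψ : IsBump Set.univ ψ := ⟨hψs, hψc, Set.subset_univ _⟩
  have hv : v = hψ.memLp.toLp := Lp.ext (hvψ.trans hψ.memLp.coeFn_toLp.symm)
  have hinner : inner ℂ hf.toLp v = ∫ x, f x * ψ x ∂μ := by
    rw [L2.inner_def]
    refine integral_congr_ae ?_
    filter_upwards [hvψ, hf.coeFn_toLp] with x hx hx'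
    rw [hx, hx']
    simp [mul_comm]
  rw [Set.mem_ofPred_eq, hinner, hv, norm_toLp_sq]
  exact h ψ hψ

theorem integral_sq_le_of_pairing_le {f : E → ℂ} (hf : MemLp f 2 μ) {M : ℝ} (hM : 0 ≤ M)
    (h : ∀ ψ, IsBump Set.univ ψ → ‖∫ x, f x * ψ x ∂μ‖ ^ 2 ≤ M * ∫ x, ‖ψ x‖ ^ 2 ∂μ) :
    ∫ x, ‖f x‖ ^ 2 ∂μ ≤ M := by
  have hconj : MemLp (fun x => star (f x)) 2 μ := hf.star
  have hself := norm_inner_sq_le_of_pairing_le hconj h hconj.toLp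
  have hnorm : ‖hconj.toLp‖ ^ 2 = ∫ x, ‖f x‖ ^ 2 ∂μ := by
    simpa only [norm_star] using norm_toLp_sq hconj
  rw [inner_self_eq_norm_sq_to_K, ← RCLike.ofReal_pow, RCLike.norm_ofReal, abs_sq, hnorm] at hself
  rcases (integral_nonneg fun x => sq_nonneg ‖f x‖ : 0 ≤ ∫ x, ‖f x‖ ^ 2 ∂μ).eq_or_lt with h0 | h0
  · exact h0 ▸ hM
  · nlinarith

theorem setLIntegral_sq_div_le_of_isCompact {K U : Set E} (hK : IsCompact K) (hU : IsOpen U)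
    (hKU : K ⊆ U) {f : E → ℂ} (hf : MemLp f 2 μ) {W : E → ℝ} (hW : ContDiff ℝ ∞ W)
    (hWpos : ∀ x ∈ U, 0 < W x) {M : ℝ} (hM : 0 ≤ M)
    (h : ∀ ψ, IsBump U ψ → ‖∫ x, f x * ψ x ∂μ‖ ^ 2 ≤ M * ∫ x, W x * ‖ψ x‖ ^ 2 ∂μ) :
    ∫⁻ x in K, ENNReal.ofReal (‖f x‖ ^ 2 / W x) ∂μ ≤ ENNReal.ofReal M := by
  obtain ⟨κ, hκ, hκ_sq, hκ_mem⟩ := exists_isBump_norm_sq_eq_inv hK hU hKU hW hWpos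
  have hκf : MemLp (fun x => κ x * f x) 2 μ := by
    obtain ⟨B, hB⟩ := hκ.smooth.continuous.bounded_above_of_compact_support hκ.compact
    exact hf.of_le_mul (hκ.smooth.continuous.aestronglyMeasurable.mul hf.1)
      (Filter.Eventually.of_forall fun x => (norm_mul _ _).trans_le (by gcongr; exact hB x))
  have hbound : ∫ x, ‖κ x * f x‖ ^ 2 ∂μ ≤ M := by
    refine integral_sq_le_of_pairing_le hκf hM fun ψ hψ => ?_
    have hweight (x : E) : W x * ‖ψ x * κ x‖ ^ 2 = W x * ‖κ x‖ ^ 2 * ‖ψ x‖ ^ 2 := by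
      rw [norm_mul]; ring
    calc ‖∫ x, κ x * f x * ψ x ∂μ‖ ^ 2 = ‖∫ x, f x * (ψ x * κ x) ∂μ‖ ^ 2 := by
          congr 3; ext x; ring
      _ ≤ M * ∫ x, W x * ‖ψ x * κ x‖ ^ 2 ∂μ := h _ (hκ.mul_left hU hψ.smooth.contDiffOn)
      _ ≤ M * ∫ x, ‖ψ x‖ ^ 2 ∂μ := by
          refine mul_le_mul_of_nonneg_left (integral_mono_of_nonneg
            (Filter.Eventually.of_forall fun x => ?_) hψ.integrable_norm_sq
            (Filter.Eventually.of_forall fun x => ?_)) hM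
          · exact (mul_nonneg (hκ_mem x).1 (sq_nonneg _)).trans_eq (hweight x).symm
          · exact (hweight x).trans_le (mul_le_of_le_one_left (sq_nonneg _) (hκ_mem x).2)
  calc ∫⁻ x in K, ENNReal.ofReal (‖f x‖ ^ 2 / W x) ∂μ
      = ∫⁻ x in K, ENNReal.ofReal (‖κ x * f x‖ ^ 2) ∂μ :=
        setLIntegral_congr_fun hK.measurableSet fun x hx => by
          simp only [norm_mul, mul_pow, hκ_sq x hx, inv_mul_eq_div]
    _ ≤ ∫⁻ x, ENNReal.ofReal (‖κ x * f x‖ ^ 2) ∂μ := setLIntegral_le_lintegral _ _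
    _ = ENNReal.ofReal (∫ x, ‖κ x * f x‖ ^ 2 ∂μ) := (ofReal_integral_eq_lintegral_ofReal
        ((memLp_two_iff_integrable_sq_norm hκf.1).1 hκf)
        (Filter.Eventually.of_forall fun x => sq_nonneg _)).symm
    _ ≤ ENNReal.ofReal M := ENNReal.ofReal_le_ofReal hbound

theorem setLIntegral_sq_div_le_of_pairing_le {U : Set E} (hU : IsOpen U) {f : E → ℂ}
    (hf : MemLp f 2 μ) {W : E → ℝ} (hW : ContDiff ℝ ∞ W) (hWpos : ∀ x ∈ U, 0 < W x) {M : ℝ}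
    (hM : 0 ≤ M)
    (h : ∀ ψ, IsBump U ψ → ‖∫ x, f x * ψ x ∂μ‖ ^ 2 ≤ M * ∫ x, W x * ‖ψ x‖ ^ 2 ∂μ) :
    ∫⁻ x in U, ENNReal.ofReal (‖f x‖ ^ 2 / W x) ∂μ ≤ ENNReal.ofReal M := by
  obtain ⟨K, hK, hKU⟩ : IsSigmaCompact U := by
    have := hU.locallyCompactSpace
    exact isSigmaCompact_iff_sigmaCompactSpace.2 inferInstance
  have hU_eq : U = ⋃ n, Set.accumulate K n := by rw [Set.iUnion_accumulate, hKU]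
  rw [hU_eq, setLIntegral_iUnion_of_directed _ Set.monotone_accumulate.directed_le]
  exact iSup_le fun n => setLIntegral_sq_div_le_of_isCompact (isCompact_accumulate hK n) hU
    ((Set.subset_iUnion _ n).trans hU_eq.symm.subset) hf hW hWpos hM h

end Duality

section Exponential

theorem hasDerivAt_cexp_mul_ofReal (c : ℂ) (s : ℝ) :
    HasDerivAt (fun s : ℝ => Complex.exp (c * s)) (c * Complex.exp (c * s)) s := by
  simpa [mul_comm] using ((hasDerivAt_id s).ofReal_comp.const_mul c).cexp

theorem eq_cexp_mul_of_hasDerivAt {c : ℂ} {y : ℝ → ℂ} (hy : ∀ s, HasDerivAt y (c * y s) s)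
    (s : ℝ) : y s = Complex.exp (c * s) * y 0 := by
  have hderiv (s : ℝ) : HasDerivAt (fun s : ℝ => Complex.exp (-c * s) * y s) 0 s :=
    ((hasDerivAt_cexp_mul_ofReal (-c) s).mul (hy s)).congr_deriv (by ring)
  have hconst : Complex.exp (-c * s) * y s = y 0 := by
    simpa using is_const_of_deriv_eq_zero (fun s => (hderiv s).differentiableAt)
      (fun s => (hderiv s).deriv) s 0
  rw [← hconst, ← mul_assoc, ← Complex.exp_add, neg_mul, add_neg_cancel, Complex.exp_zero, one_mul]

end Exponential

section Flow

variable {E : Type*} [NormedAddCommGroup E] [NormedSpace ℝ E]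

/-- The one-parameter group `s ↦ exp (s V)` generated by the linear vector field `V`. -/
noncomputable def flow (V : E →L[ℝ] E) (s : ℝ) : E →L[ℝ] E := NormedSpace.exp (s • V)

theorem flow_zero (V : E →L[ℝ] E) (x : E) : flow V 0 x = x := by
  simp [flow]

theorem flow_apply_comm (V : E →L[ℝ] E) (s : ℝ) (x : E) : V (flow V s x) = flow V s (V x) :=
  DFunLike.congr_fun (((Commute.refl V).smul_right s).exp_right).eq x

theorem fderiv_comp_flow (V : E →L[ℝ] E) {ψ : E → ℂ} (hψ : ContDiff ℝ ∞ ψ) (s : ℝ) (x : E) :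
    fderiv ℝ (fun y => ψ (flow V s y)) x (V x) =
      fderiv ℝ ψ (flow V s x) (V (flow V s x)) := by
  have hcomp := (hψ.differentiable (by simp) (flow V s x)).hasFDerivAt.comp x (flow V s).hasFDerivAt
  rw [flow_apply_comm]
  exact DFunLike.congr_fun hcomp.fderiv (V x)

variable [CompleteSpace E] (V : E →L[ℝ] E)

theorem flow_add (s t : ℝ) (x : E) : flow V (s + t) x = flow V s (flow V t x) := by
  let := NormedAlgebra.restrictScalars ℚ ℝ (E →L[ℝ] E)
  rw [flow, add_smul, NormedSpace.exp_add_of_commute ((Commute.refl V).smul_left s |>.smul_right t)]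
  rfl

theorem flow_neg_flow (s : ℝ) (x : E) : flow V (-s) (flow V s x) = x := by
  rw [← flow_add, neg_add_cancel, flow_zero]

theorem flow_flow_neg (s : ℝ) (x : E) : flow V s (flow V (-s) x) = x := by
  rw [← flow_add, add_neg_cancel, flow_zero]

theorem hasDerivAt_flow (s : ℝ) (x : E) :
    HasDerivAt (fun s => flow V s x) (V (flow V s x)) s :=
  (hasDerivAt_exp_smul_const' V s).clm_apply (hasDerivAt_const s x) |>.congr_deriv (by simp; rfl)

theorem continuous_flow : Continuous fun p : ℝ × E => flow V p.1 p.2 :=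
  (((differentiable_exp_smul_const ℝ V).continuous.comp continuous_fst).clm_apply continuous_snd)

theorem apply_flow_of_eigen {T : E →L[ℝ] ℂ} {c : ℂ} (hT : ∀ x, T (V x) = c * T x) (s : ℝ) (x : E) :
    T (flow V s x) = Complex.exp (c * s) * T x := by
  have hderiv (s : ℝ) : HasDerivAt (fun s => T (flow V s x)) (c * T (flow V s x)) s :=
    hT (flow V s x) ▸ T.hasFDerivAt.comp_hasDerivAt s (hasDerivAt_flow V s x)
  simpa only [flow_zero] using eq_cexp_mul_of_hasDerivAt hderiv s

/-- The map `exp (s V)` as a homeomorphism. -/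
noncomputable def flowHomeomorph (s : ℝ) : E ≃ₜ E where
  toFun := flow V s
  invFun := flow V (-s)
  left_inv := flow_neg_flow V s
  right_inv := flow_flow_neg V s
  continuous_toFun := (flow V s).continuous
  continuous_invFun := (flow V (-s)).continuous

theorem hasDerivAt_comp_flow {ψ : E → ℂ} (hψ : ContDiff ℝ ∞ ψ) (s : ℝ) (x : E) :
    HasDerivAt (fun s => ψ (flow V s x)) (fderiv ℝ ψ (flow V s x) (V (flow V s x))) s :=
  (hψ.differentiable (by simp) (flow V s x)).hasFDerivAt.comp_hasDerivAt s (hasDerivAt_flow V s x)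

theorem IsBump.comp_flow {U : Set E} {ψ : E → ℂ} (hψ : IsBump U ψ)
    (hU : ∀ s, ∀ x ∈ U, flow V s x ∈ U) (s : ℝ) : IsBump U (fun x => ψ (flow V s x)) := by
  refine ⟨hψ.smooth.comp (flow V s).contDiff, hψ.compact.comp_homeomorph (flowHomeomorph V s),
    fun x hx => ?_⟩
  have hsubset : tsupport (fun x => ψ (flow V s x)) ⊆ flow V s ⁻¹' tsupport ψ :=
    closure_minimal (fun x hx => subset_tsupport ψ hx)
      ((isClosed_tsupport ψ).preimage (flow V s).continuous)
  exact flow_neg_flow V s x ▸ hU (-s) _ (hψ.support (hsubset hx))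

theorem exists_integrable_bound_mul_comp_flow [MeasurableSpace E] [BorelSpace E] {μ : Measure E}
    {A : Type*} [NormedRing A] {f u : E → A} (hf : LocallyIntegrable f μ) (hu : Continuous u)
    (huc : HasCompactSupport u) (a b : ℝ) :
    ∃ B : E → ℝ, Integrable B μ ∧ ∀ s ∈ Set.Icc a b, ∀ x, ‖f x * u (flow V s x)‖ ≤ B x := by
  -- This compact set contains the support of `u ∘ flow V s` for every `s ∈ [a, b]`.
  have hK : IsCompact ((fun p : ℝ × E => flow V p.1 p.2) '' (Set.Icc (-b) (-a) ×ˢ tsupport u)) :=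
    (isCompact_Icc.prod huc).image (continuous_flow V)
  obtain ⟨C, hC⟩ := hu.bounded_above_of_compact_support huc
  refine ⟨_, (integrable_indicator_iff hK.measurableSet).2
    ((hf.integrableOn_isCompact hK).norm.mul_const C), fun s hs x => ?_⟩
  by_cases hx : flow V s x ∈ tsupport u
  · have hxK : x ∈ (fun p : ℝ × E => flow V p.1 p.2) '' (Set.Icc (-b) (-a) ×ˢ tsupport u) :=
      ⟨(-s, flow V s x), ⟨⟨neg_le_neg hs.2, neg_le_neg hs.1⟩, hx⟩, flow_neg_flow V s x⟩
    rw [Set.indicator_of_mem hxK]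
    exact (norm_mul_le _ _).trans (mul_le_mul_of_nonneg_left (hC _) (norm_nonneg _))
  · rw [image_eq_zero_of_notMem_tsupport hx, mul_zero, norm_zero]
    exact Set.indicator_nonneg
      (fun y _ => mul_nonneg (norm_nonneg _) ((norm_nonneg _).trans (hC 0))) x

end Flow

section Jacobian

variable {E : Type*} [NormedAddCommGroup E] [NormedSpace ℝ E] [FiniteDimensional ℝ E]

theorem differentiable_det : Differentiable ℝ fun A : E →L[ℝ] E => A.det := by
  classical
  let b := Module.finBasis ℝ E
  have hdet (A : E →L[ℝ] E) : A.det = ∑ σ : Equiv.Perm _, Equiv.Perm.sign σ •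
      ∏ i, (LinearMap.toContinuousLinearMap (b.coord (σ i))) (A (b i)) := by
    rw [ContinuousLinearMap.det, ← LinearMap.det_toMatrix b, Matrix.det_apply]
    simp [LinearMap.toMatrix_apply]
  simp_rw [hdet]
  fun_prop

theorem hasDerivAt_det_one_add_smul (V : E →L[ℝ] E) :
    HasDerivAt (fun s : ℝ => (1 + s • V).det) (LinearMap.trace ℝ E V) 0 := by
  classical
  let b := Module.finBasis ℝ E
  set M := LinearMap.toMatrix b b (V : E →ₗ[ℝ] E) with hM
  have hdet (s : ℝ) : (1 + s • V).det = (1 + s • M).det := by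
    rw [ContinuousLinearMap.det, ← LinearMap.det_toMatrix b]
    congr 1
    simp [hM, LinearMap.toMatrix_one]
  obtain ⟨q, hq⟩ : ∃ q : Polynomial ℝ, ∀ s : ℝ,
      (1 + s • M).det = 1 + M.trace * s + q.eval s * s ^ 2 :=
    ⟨_, fun s => Matrix.det_one_add_smul s M⟩
  simp only [hdet, hq, LinearMap.trace_eq_matrix_trace ℝ b]
  exact ((((hasDerivAt_id (0 : ℝ)).const_mul M.trace).const_add 1).add
    ((q.hasDerivAt 0).mul (hasDerivAt_pow 2 0))).congr_deriv (by simp [hM])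

theorem hasDerivAt_det_flow_zero (V : E →L[ℝ] E) :
    HasDerivAt (fun s : ℝ => (flow V s).det) (LinearMap.trace ℝ E V) 0 := by
  have hline : HasDerivAt (fun s : ℝ => 1 + s • V) V 0 := by
    simpa using ((hasDerivAt_id (0 : ℝ)).smul_const V).const_add 1
  have hflow : HasDerivAt (flow V) V 0 := by
    exact (hasDerivAt_exp_smul_const' V (0 : ℝ)).congr_deriv (by simp)
  have hdet := (differentiable_det (1 : E →L[ℝ] E)).hasFDerivAt
  have hdet_line := hdet.comp_hasDerivAt_of_eq 0 hline (by simp)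
  have hdet_flow := hdet.comp_hasDerivAt_of_eq 0 hflow (by simp [flow])
  exact hdet_line.unique (hasDerivAt_det_one_add_smul V) ▸ hdet_flow

theorem det_flow (V : E →L[ℝ] E) (s : ℝ) :
    (flow V s).det = Real.exp (LinearMap.trace ℝ E V * s) := by
  have hadd (s t : ℝ) : (flow V (s + t)).det = (flow V s).det * (flow V t).det := by
    rw [ContinuousLinearMap.det, ContinuousLinearMap.det, ContinuousLinearMap.det,
      ← LinearMap.det_comp]
    exact congrArg LinearMap.det (LinearMap.ext (flow_add V s t))
  have hderiv (s : ℝ) : HasDerivAt (fun s => ((flow V s).det : ℂ))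
      ((LinearMap.trace ℝ E V : ℂ) * (flow V s).det) s := by
    have hzero : HasDerivAt (fun t => (flow V t).det) (LinearMap.trace ℝ E V) (s - s) := by
      rw [sub_self]
      exact hasDerivAt_det_flow_zero V
    have hshift := ((hzero.comp_sub_const s s).mul_const (flow V s).det).ofReal_comp
    simpa only [← hadd, sub_add_cancel, Complex.ofReal_mul] using hshift
  have hsol := eq_cexp_mul_of_hasDerivAt hderiv s
  have hone : (flow V 0).det = 1 := by simp [flow, ContinuousLinearMap.det]
  rw [hone, Complex.ofReal_one, mul_one] at hsol
  exact_mod_cast hsol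

variable [MeasurableSpace E] [BorelSpace E] {μ : Measure E} [μ.IsAddHaarMeasure]

theorem integral_comp_flow {F : Type*} [NormedAddCommGroup F] [NormedSpace ℝ F]
    (V : E →L[ℝ] E) (u : E → F) (s : ℝ) :
    ∫ x, u (flow V s x) ∂μ = Real.exp (-(LinearMap.trace ℝ E V * s)) • ∫ x, u x ∂μ := by
  have hdet : (flow V s).det ≠ 0 := det_flow V s ▸ (Real.exp_pos _).ne'
  have hmap := Measure.map_linearMap_addHaar_eq_smul_addHaar μ hdet
  rw [ContinuousLinearMap.coe_coe, ← ContinuousLinearMap.det, det_flow, ← Real.exp_neg,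
    abs_of_pos (Real.exp_pos _)] at hmap
  have hint := (flowHomeomorph V s).measurableEmbedding.integral_map (μ := μ) u
  rw [show ⇑(flowHomeomorph V s) = flow V s from rfl, hmap, integral_smul_measure,
    ENNReal.toReal_ofReal (Real.exp_pos _).le] at hint
  exact hint.symm

end Jacobian

section FlowIntegral

variable {E : Type*} [NormedAddCommGroup E] [NormedSpace ℝ E] [CompleteSpace E]
  [SecondCountableTopology E] [MeasurableSpace E] [BorelSpace E] (V : E →L[ℝ] E) {μ : Measure E}

theorem hasDerivAt_integral_mul_comp_flow {U : Set E} {f ψ : E → ℂ} (hf : LocallyIntegrable f μ)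
    (hψ : IsBump U ψ) (s : ℝ) :
    HasDerivAt (fun s => ∫ x, f x * ψ (flow V s x) ∂μ)
      (∫ x, f x * fderiv ℝ ψ (flow V s x) (V (flow V s x)) ∂μ) s := by
  have hdψ : IsBump U (fun x => fderiv ℝ ψ x (V x)) := hψ.fderiv_apply V.contDiff
  have hmeas (u : E → ℂ) (hu : Continuous u) (t : ℝ) :
      AEStronglyMeasurable (fun x => f x * u (flow V t x)) μ :=
    hf.aestronglyMeasurable.mul (hu.comp (flow V t).continuous).aestronglyMeasurable
  obtain ⟨B, hB, hfψ⟩ := exists_integrable_bound_mul_comp_flow V hf hψ.smooth.continuous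
    hψ.compact s s
  obtain ⟨B', hB', hfdψ⟩ := exists_integrable_bound_mul_comp_flow V hf hdψ.smooth.continuous
    hdψ.compact (s - 1) (s + 1)
  exact (hasDerivAt_integral_of_dominated_loc_of_deriv_le (𝕜 := ℝ)
    (Ioo_mem_nhds (sub_one_lt s) (lt_add_one s))
    (.of_forall (hmeas ψ hψ.smooth.continuous))
    (hB.mono' (hmeas ψ hψ.smooth.continuous s) (.of_forall (hfψ s (Set.left_mem_Icc.2 le_rfl))))
    (hmeas _ hdψ.smooth.continuous s)
    (.of_forall fun x t ht => hfdψ t (Set.Ioo_subset_Icc_self ht) x) hB'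
    (.of_forall fun x t _ => (hasDerivAt_comp_flow V hψ.smooth t x).const_mul (f x))).2

theorem integral_mul_integral_comp_flow {𝕜 : Type*} [RCLike 𝕜] [SFinite μ] {f u : E → 𝕜}
    (hf : LocallyIntegrable f μ) (hu : Continuous u) (huc : HasCompactSupport u) {k : ℝ → 𝕜}
    (hk : Continuous k) {b : ℝ} (hb : 0 ≤ b) :
    ∫ s in (0 : ℝ)..b, k s * ∫ x, f x * u (flow V s x) ∂μ =
      ∫ x, f x * (∫ s in (0 : ℝ)..b, k s * u (flow V s x)) ∂μ := by
  obtain ⟨B, hB, hfu⟩ := exists_integrable_bound_mul_comp_flow V hf hu huc 0 b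
  obtain ⟨D, hD⟩ := isCompact_Icc.exists_bound_of_continuousOn (hk.continuousOn (s := Set.Icc 0 b))
  have hint : Integrable (Function.uncurry fun (s : ℝ) (x : E) => k s * (f x * u (flow V s x)))
      ((volume.restrict (Set.Ioc 0 b)).prod μ) := by
    refine ((hB.const_mul D).comp_snd (volume.restrict (Set.Ioc 0 b))).mono' ?_ ?_
    · exact (hk.comp continuous_fst).aestronglyMeasurable.mul
        (hf.aestronglyMeasurable.comp_snd.mul (hu.comp (continuous_flow V)).aestronglyMeasurable)
    · have hIoc : ∀ᵐ z ∂((volume.restrict (Set.Ioc 0 b)).prod μ), z.1 ∈ Set.Ioc 0 b :=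
        Measure.quasiMeasurePreserving_fst.ae (ae_restrict_mem measurableSet_Ioc)
      filter_upwards [hIoc] with z hz
      have hz := Set.Ioc_subset_Icc_self hz
      rw [Function.uncurry, norm_mul]
      exact mul_le_mul (hD z.1 hz) (hfu z.1 hz z.2) (norm_nonneg _)
        ((norm_nonneg _).trans (hD z.1 hz))
  have hswap := integral_integral_swap hint
  simp only [intervalIntegral.integral_of_le hb, ← integral_const_mul, mul_left_comm (f _)]
  exact hswap

end FlowIntegral

theorem norm_integral_mul_sq_le {X : Type*} [MeasurableSpace X] {μ : Measure X} {u v : X → ℂ}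
    {W R : X → ℝ} (hW : ∀ x, 0 ≤ W x) (hR : ∀ x, 0 ≤ R x) (hu : ∀ x, ‖u x‖ ^ 2 ≤ W x * R x)
    (hRi : Integrable R μ) (hv : Integrable (fun x => W x * ‖v x‖ ^ 2) μ) :
    ‖∫ x, u x * v x ∂μ‖ ^ 2 ≤ (∫ x, R x ∂μ) * ∫ x, W x * ‖v x‖ ^ 2 ∂μ := by
  have hWv (x : X) : 0 ≤ W x * ‖v x‖ ^ 2 := mul_nonneg (hW x) (sq_nonneg _)
  have hmemLp (g : X → ℝ) (hg0 : ∀ x, 0 ≤ g x) (hg : Integrable g μ) :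
      MemLp (fun x => √(g x)) 2 μ := by
    rw [memLp_two_iff_integrable_sq (Real.continuous_sqrt.comp_aestronglyMeasurable hg.1)]
    simpa only [Real.sq_sqrt (hg0 _)] using hg
  have hle (x : X) : ‖u x * v x‖ ≤ √(R x) * √(W x * ‖v x‖ ^ 2) := by
    rw [← Real.sqrt_mul (hR x)]
    refine Real.le_sqrt_of_sq_le ?_
    rw [norm_mul, mul_pow]
    exact (mul_le_mul_of_nonneg_right (hu x) (sq_nonneg _)).trans_eq (by ring)
  have hhoelder := integral_mul_le_Lp_mul_Lq_of_nonneg Real.HolderConjugate.two_two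
    (.of_forall fun x => Real.sqrt_nonneg (R x))
    (.of_forall fun x => Real.sqrt_nonneg (W x * ‖v x‖ ^ 2))
    (by simpa only [ENNReal.ofReal_ofNat] using hmemLp R hR hRi)
    (by simpa only [ENNReal.ofReal_ofNat] using hmemLp _ hWv hv)
  simp only [Real.rpow_two, ← Real.sqrt_eq_rpow, Real.sq_sqrt (hR _), Real.sq_sqrt (hWv _)]
    at hhoelder
  have hint : ‖∫ x, u x * v x ∂μ‖ ≤ √(∫ x, R x ∂μ) * √(∫ x, W x * ‖v x‖ ^ 2 ∂μ) :=
    (norm_integral_le_of_norm_le ((hmemLp R hR hRi).integrable_mul (hmemLp _ hWv hv))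
      (.of_forall hle)).trans hhoelder
  rw [← Real.sqrt_mul (integral_nonneg hR)] at hint
  exact (Real.le_sqrt (norm_nonneg _)
    (mul_nonneg (integral_nonneg hR) (integral_nonneg hWv))).1 hint

section Circle

theorem fourierCoeffOn_deriv_of_eq {a b : ℝ} (hab : a < b) {y y' : ℝ → ℂ}
    (hy : ∀ t, HasDerivAt y (y' t) t) (hy' : Continuous y') (hper : y b = y a) (q : ℤ) :
    fourierCoeffOn hab y' q =
      2 * Real.pi * Complex.I * q / (b - a) * fourierCoeffOn hab y q := by
  obtain rfl | hq := eq_or_ne q 0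
  · rw [fourierCoeffOn_eq_integral]
    simp [intervalIntegral.integral_eq_sub_of_hasDerivAt (fun t _ => hy t)
      (hy'.intervalIntegrable a b), hper]
  · have hab' : (b - a : ℂ) ≠ 0 := by exact_mod_cast (sub_pos.2 hab).ne'
    have hq' : (q : ℂ) ≠ 0 := by exact_mod_cast hq
    have hpi : (Real.pi : ℂ) ≠ 0 := by exact_mod_cast Real.pi_ne_zero
    rw [fourierCoeffOn_of_hasDerivAt hab hq (fun x _ => hy x) (hy'.intervalIntegrable _ _), hper,
      sub_self, mul_zero, zero_sub]
    field_simp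

theorem fourierCoeffOn_sub_const_mul {a b : ℝ} (hab : a < b) {y z : ℝ → ℂ} (hy : Continuous y)
    (hz : Continuous z) (c : ℂ) (q : ℤ) :
    fourierCoeffOn hab (fun t => z t - c * y t) q =
      fourierCoeffOn hab z q - c * fourierCoeffOn hab y q := by
  have hF : Continuous fun x : ℝ => fourier (-q) (x : AddCircle (b - a)) :=
    (map_continuous (fourier (-q))).comp (AddCircle.continuous_mk' _)
  simp only [fourierCoeffOn_eq_integral, smul_eq_mul, Complex.real_smul, mul_sub,
    mul_left_comm _ c]
  rw [intervalIntegral.integral_sub, intervalIntegral.integral_const_mul, mul_sub,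
    mul_left_comm _ c]
  · exact (hF.mul hz).intervalIntegrable _ _
  · exact (continuous_const.mul (hF.mul hy)).intervalIntegrable _ _

theorem hasDerivAt_integral_cexp_mul_shift (c : ℂ) {T : ℝ} {h : ℝ → ℂ} (hc : Continuous h)
    (hper : Function.Periodic h T) (t : ℝ) :
    HasDerivAt (fun t => ∫ s in (0 : ℝ)..T, Complex.exp (-c * s) * h (s + t))
      (c * (∫ s in (0 : ℝ)..T, Complex.exp (-c * s) * h (s + t)) +
        (Complex.exp (-c * T) - 1) * h t) t := by
  have heh : Continuous fun s : ℝ => Complex.exp (-c * s) * h s := by fun_prop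
  have hshift (t : ℝ) : ∫ s in (0 : ℝ)..T, Complex.exp (-c * s) * h (s + t) =
      Complex.exp (c * t) * ((∫ s in (0 : ℝ)..(t + T), Complex.exp (-c * s) * h s) -
        ∫ s in (0 : ℝ)..t, Complex.exp (-c * s) * h s) := by
    rw [intervalIntegral.integral_interval_sub_left (heh.intervalIntegrable _ _)
      (heh.intervalIntegrable _ _), add_comm t T, ← zero_add t, ← add_assoc, add_zero,
      ← intervalIntegral.integral_comp_add_right, ← intervalIntegral.integral_const_mul, zero_add]
    refine intervalIntegral.integral_congr fun s _ => ?_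
    rw [← mul_assoc, ← Complex.exp_add]
    congr 2
    push_cast
    ring
  have hprimitive (t : ℝ) := (heh.integral_hasStrictDerivAt 0 t).hasDerivAt
  rw [funext hshift, hshift]
  refine ((hasDerivAt_cexp_mul_ofReal c t).mul
    (((hprimitive (t + T)).comp_add_const t T).sub (hprimitive t))).congr_deriv ?_
  have hend : Complex.exp (c * t) * Complex.exp (-c * (t + T : ℝ)) = Complex.exp (-c * T) := by
    rw [← Complex.exp_add]
    congr 1
    push_cast
    ring
  have hstart : Complex.exp (c * t) * Complex.exp (-c * t) = 1 := by
    rw [← Complex.exp_add, neg_mul, add_neg_cancel, Complex.exp_zero]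
  simp only [Pi.sub_apply]
  rw [hper t]
  linear_combination h t * hend - h t * hstart

theorem mul_integral_sq_le_integral_deriv_sub {α m : ℝ}
    (hm : ∀ q : ℤ, m ≤ |α - 2 * q| ^ 2) {y y' : ℝ → ℂ} (hy : ∀ t, HasDerivAt y (y' t) t)
    (hy' : Continuous y') (hper : y Real.pi = y 0) :
    m * ∫ t in (0 : ℝ)..Real.pi, ‖y t‖ ^ 2 ≤
      ∫ t in (0 : ℝ)..Real.pi, ‖y' t - Complex.I * α * y t‖ ^ 2 := by
  have hyc : Continuous y := continuous_iff_continuousAt.2 fun t => (hy t).continuousAt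
  have hparseval (u : ℝ → ℂ) (hu : Continuous u) :=
    hasSum_sq_fourierCoeffOn Real.pi_pos (f := u) <| by
      rw [memLp_two_iff_integrable_sq_norm hu.aestronglyMeasurable]
      exact ((hu.norm.pow 2).integrableOn_Icc).mono_set Set.Ioc_subset_Icc_self
  have hcoeff (q : ℤ) : m * ‖fourierCoeffOn Real.pi_pos y q‖ ^ 2 ≤
      ‖fourierCoeffOn Real.pi_pos (fun t => y' t - Complex.I * α * y t) q‖ ^ 2 := by
    have hfactor : 2 * Real.pi * Complex.I * q / (Real.pi - (0 : ℝ)) - Complex.I * α =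
        -Complex.I * ((α - 2 * q : ℝ) : ℂ) := by
      have hpi : (Real.pi : ℂ) ≠ 0 := by exact_mod_cast Real.pi_ne_zero
      push_cast
      field_simp
      ring
    rw [fourierCoeffOn_sub_const_mul _ hyc hy', fourierCoeffOn_deriv_of_eq _ hy hy' hper, ← sub_mul,
      hfactor, norm_mul, norm_mul, norm_neg, Complex.norm_I, one_mul, Complex.norm_real, mul_pow,
      Real.norm_eq_abs]
    exact mul_le_mul_of_nonneg_right (hm q) (sq_nonneg _)
  have hsum := hasSum_le hcoeff ((hparseval y hyc).mul_left m) (hparseval _ (by fun_prop))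
  rw [sub_zero, smul_eq_mul, smul_eq_mul, mul_left_comm] at hsum
  exact le_of_mul_le_mul_left hsum (inv_pos.2 Real.pi_pos)

theorem mul_integral_sq_average_le {α m : ℝ} (hm : ∀ q : ℤ, m ≤ |α - 2 * q| ^ 2) {h : ℝ → ℂ}
    (hc : Continuous h) (hper : Function.Periodic h Real.pi) :
    m * ∫ t in (0 : ℝ)..Real.pi,
        ‖∫ s in (0 : ℝ)..Real.pi, Complex.exp (-(Complex.I * α) * s) * h (s + t)‖ ^ 2 ≤
      ‖Complex.exp (-(Complex.I * α) * Real.pi) - 1‖ ^ 2 *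
        ∫ t in (0 : ℝ)..Real.pi, ‖h t‖ ^ 2 := by
  have hderiv := hasDerivAt_integral_cexp_mul_shift (Complex.I * α) hc hper
  have := continuous_iff_continuousAt.2 fun t => (hderiv t).continuousAt
  refine (mul_integral_sq_le_integral_deriv_sub hm hderiv (by fun_prop) ?_).trans_eq ?_
  · simp only [hper _, add_zero]
  · simp only [add_sub_cancel_left, norm_mul, mul_pow, intervalIntegral.integral_const_mul]

end Circle

theorem integrable_mul_norm_sq {X : Type*} [TopologicalSpace X] [MeasurableSpace X]
    [OpensMeasurableSpace X] {μ : Measure X} [IsFiniteMeasureOnCompacts μ] {W : X → ℝ} {v : X → ℂ}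
    (hW : Continuous W) (hv : Continuous v) (hvc : HasCompactSupport v) :
    Integrable (fun x => W x * ‖v x‖ ^ 2) μ := by
  refine Continuous.integrable_of_hasCompactSupport (by fun_prop) ?_
  exact (hvc.comp_left (g := fun z : ℂ => ‖z‖ ^ 2) (by simp)).mul_left (f := W)

section WeakDeriv

variable {E : Type*} [NormedAddCommGroup E] [NormedSpace ℝ E] [MeasurableSpace E]

/-- `h = (-i V·∇ + c) f` in the sense of distributions on `U`. The trace is the divergence of the
linear vector field `V`, which appears when the derivative is moved to the test function. -/
def IsWeakDeriv (μ : Measure E) (V : E →L[ℝ] E) (c : ℝ) (U : Set E) (f h : E → ℂ) : Prop :=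
  ∀ ψ : E → ℂ, IsBump U ψ → ∫ x, h x * ψ x ∂μ =
    ∫ x, f x * (Complex.I * fderiv ℝ ψ x (V x) +
      (Complex.I * LinearMap.trace ℝ E V + c) * ψ x) ∂μ

/-- A smooth weight, positive on `U`, which is homogeneous of degree `β` under the flow of `V`. -/
structure IsWeight (V : E →L[ℝ] E) (U : Set E) (β : ℝ) (W : E → ℝ) : Prop where
  smooth : ContDiff ℝ ∞ W
  nonneg : ∀ x, 0 ≤ W x
  pos : ∀ x ∈ U, 0 < W x
  homogeneous : ∀ s x, W (flow V s x) = Real.exp (β * s) * W x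

variable [FiniteDimensional ℝ E] [BorelSpace E] {μ : Measure E} {V : E →L[ℝ] E} {U : Set E}
  {W : E → ℝ} {β : ℝ}

theorem IsWeakDeriv.hasDerivAt_integral {c : ℝ} {f h ψ : E → ℂ} (hfh : IsWeakDeriv μ V c U f h)
    (hf : LocallyIntegrable f μ) (hU : ∀ s, ∀ x ∈ U, flow V s x ∈ U) (hψ : IsBump U ψ) (s : ℝ) :
    HasDerivAt (fun s => ∫ x, f x * ψ (flow V s x) ∂μ)
      (-Complex.I * (∫ x, h x * ψ (flow V s x) ∂μ) -
        (LinearMap.trace ℝ E V - Complex.I * c) * ∫ x, f x * ψ (flow V s x) ∂μ) s := by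
  refine (hasDerivAt_integral_mul_comp_flow V hf hψ s).congr_deriv ?_
  have hψs : IsBump U fun x => ψ (flow V s x) := hψ.comp_flow V hU s
  have hpairing := hfh _ hψs
  simp only [mul_add, mul_left_comm (f _)] at hpairing
  rw [integral_add ((hψs.fderiv_apply V.contDiff).integrable_mul hf |>.const_mul _)
    ((hψs.integrable_mul hf).const_mul _), integral_const_mul, integral_const_mul] at hpairing
  simp only [fderiv_comp_flow V hψ.smooth] at hpairing
  rw [hpairing]
  linear_combination ((∫ x, f x * fderiv ℝ ψ (flow V s x) (V (flow V s x)) ∂μ) +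
    LinearMap.trace ℝ E V * ∫ x, f x * ψ (flow V s x) ∂μ) * Complex.I_sq

variable [μ.IsAddHaarMeasure]

theorem IsWeight.integral_mul_norm_sq_comp_flow (hW : IsWeight V U β W) (ψ : E → ℂ) (s : ℝ) :
    ∫ x, W x * ‖ψ (flow V s x)‖ ^ 2 ∂μ =
      Real.exp (-((β + LinearMap.trace ℝ E V) * s)) * ∫ x, W x * ‖ψ x‖ ^ 2 ∂μ := by
  have hchange := integral_comp_flow V (fun x => W x * ‖ψ x‖ ^ 2) s (μ := μ)
  simp only [hW.homogeneous, mul_assoc, integral_const_mul, smul_eq_mul] at hchange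
  rw [add_mul, neg_add, Real.exp_add, mul_assoc, ← hchange, ← mul_assoc, ← Real.exp_add,
    neg_add_cancel, Real.exp_zero, one_mul]

theorem IsWeight.norm_integral_mul_comp_flow_le (hW : IsWeight V U β W) {u : E → ℂ} {R : E → ℝ}
    (hR : ∀ x, 0 ≤ R x) (hRi : Integrable R μ) (hu : ∀ x, ‖u x‖ ^ 2 ≤ W x * R x) {ψ : E → ℂ}
    (hψ : IsBump U ψ) (hU : ∀ s, ∀ x ∈ U, flow V s x ∈ U) (s : ℝ) :
    ‖∫ x, u x * ψ (flow V s x) ∂μ‖ ≤ √((∫ x, R x ∂μ) * ∫ x, W x * ‖ψ x‖ ^ 2 ∂μ) *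
      Real.exp (-((β + LinearMap.trace ℝ E V) / 2 * s)) := by
  have hψs : IsBump U fun x => ψ (flow V s x) := hψ.comp_flow V hU s
  have hcs := norm_integral_mul_sq_le hW.nonneg hR hu hRi
    (integrable_mul_norm_sq hW.smooth.continuous hψs.smooth.continuous hψs.compact)
  have hexp : Real.exp (-((β + LinearMap.trace ℝ E V) * s)) =
      Real.exp (-((β + LinearMap.trace ℝ E V) / 2 * s)) ^ 2 := by
    rw [← Real.exp_nat_mul]
    ring_nf
  rw [hW.integral_mul_norm_sq_comp_flow, hexp, mul_left_comm, mul_comm] at hcs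
  rw [← Real.sqrt_sq (Real.exp_pos _).le, ← Real.sqrt_mul (mul_nonneg (integral_nonneg hR)
    (integral_nonneg fun x => mul_nonneg (hW.nonneg x) (sq_nonneg _)))]
  exact Real.le_sqrt_of_sq_le hcs

end WeakDeriv

section Dilation

theorem mul_norm_le_of_hasDerivAt_of_tendsto_atBot {P P' : ℝ → ℂ} {M κ : ℝ} (hκ : 0 < κ)
    (hP : ∀ s, HasDerivAt P (P' s) s) (hP' : ∀ s, ‖P' s‖ ≤ M * Real.exp (κ * s))
    (hlim : Filter.Tendsto P Filter.atBot (nhds 0)) : κ * ‖P 0‖ ≤ M := by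
  have hM : 0 ≤ M / κ :=
    div_nonneg (by simpa using (norm_nonneg _).trans (hP' 0)) hκ.le
  have hle (a : ℝ) (ha : a ≤ 0) : ‖P 0‖ ≤ ‖P a‖ + M / κ := by
    have hB (s : ℝ) : HasDerivAt (fun s => ‖P a‖ + M / κ * Real.exp (κ * s))
        (M * Real.exp (κ * s)) s := by
      refine ((((hasDerivAt_id s).const_mul κ).exp.const_mul (M / κ)).const_add _).congr_deriv ?_
      simp only [id, mul_one]
      field_simp
    have hbound := image_norm_le_of_norm_deriv_right_le_deriv_boundary
      (fun s _ => (hP s).continuousAt.continuousWithinAt) (fun s _ => (hP s).hasDerivWithinAt)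
      (B := fun s => ‖P a‖ + M / κ * Real.exp (κ * s))
      (le_add_of_nonneg_right (mul_nonneg hM (Real.exp_pos _).le)) hB (fun s _ => hP' s)
      (Set.right_mem_Icc.2 ha)
    simpa only [mul_zero, Real.exp_zero, mul_one] using hbound
  have hlim' := ge_of_tendsto (hlim.norm.add_const (M / κ))
    ((Filter.eventually_le_atBot 0).mono hle)
  rwa [norm_zero, zero_add, le_div_iff₀' hκ] at hlim'

variable {E : Type*} [NormedAddCommGroup E] [NormedSpace ℝ E] [FiniteDimensional ℝ E]
  [MeasurableSpace E] [BorelSpace E] {μ : Measure E} [μ.IsAddHaarMeasure]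
  {V : E →L[ℝ] E} {U : Set E} {β : ℝ} {W R : E → ℝ} {f h : E → ℂ}

theorem tendsto_exp_mul_integral_comp_flow (hV : 0 < LinearMap.trace ℝ E V)
    (hU : ∀ s, ∀ x ∈ U, flow V s x ∈ U) (hf : MemLp f 2 μ) {ψ : E → ℂ} (hψ : IsBump U ψ) :
    Filter.Tendsto (fun s => (Real.exp (LinearMap.trace ℝ E V * s) : ℂ) *
      ∫ x, f x * ψ (flow V s x) ∂μ) Filter.atBot (nhds 0) := by
  have hone : IsWeight V U 0 (fun _ => 1) :=
    ⟨contDiff_const, fun _ => zero_le_one, fun _ _ => zero_lt_one, by simp⟩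
  have hbound := hone.norm_integral_mul_comp_flow_le (fun x => sq_nonneg ‖f x‖)
    ((memLp_two_iff_integrable_sq_norm hf.1).1 hf) (fun x => (one_mul _).ge) hψ hU
  have hexp : Filter.Tendsto (fun s => Real.exp (LinearMap.trace ℝ E V / 2 * s)) Filter.atBot
      (nhds 0) := Real.tendsto_exp_atBot.comp (Filter.tendsto_id.const_mul_atBot (half_pos hV))
  have hlim := hexp.const_mul √((∫ x, ‖f x‖ ^ 2 ∂μ) * ∫ x, 1 * ‖ψ x‖ ^ 2 ∂μ)
  rw [mul_zero] at hlim
  refine squeeze_zero_norm (fun s => ?_) hlim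
  rw [norm_mul, Complex.norm_real, Real.norm_of_nonneg (Real.exp_pos _).le]
  refine (mul_le_mul_of_nonneg_left (hbound s) (Real.exp_pos _).le).trans_eq ?_
  rw [mul_left_comm, ← Real.exp_add]
  ring_nf

theorem IsWeakDeriv.mul_norm_integral_le (hfh : IsWeakDeriv μ V 0 U f h) (hf : MemLp f 2 μ)
    (hU : ∀ s, ∀ x ∈ U, flow V s x ∈ U) (hW : IsWeight V U β W) (hβ : β < LinearMap.trace ℝ E V)
    (hV : 0 < LinearMap.trace ℝ E V) (hR : ∀ x, 0 ≤ R x) (hRi : Integrable R μ)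
    (hh : ∀ x, ‖h x‖ ^ 2 ≤ W x * R x) {ψ : E → ℂ} (hψ : IsBump U ψ) :
    (LinearMap.trace ℝ E V - β) / 2 * ‖∫ x, f x * ψ x ∂μ‖ ≤
      √((∫ x, R x ∂μ) * ∫ x, W x * ‖ψ x‖ ^ 2 ∂μ) := by
  have hderiv (s : ℝ) : HasDerivAt (fun s : ℝ => (Real.exp (LinearMap.trace ℝ E V * s) : ℂ) *
      ∫ x, f x * ψ (flow V s x) ∂μ) ((Real.exp (LinearMap.trace ℝ E V * s) : ℂ) *
        (-Complex.I * ∫ x, h x * ψ (flow V s x) ∂μ)) s := by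
    simp only [Complex.ofReal_exp, Complex.ofReal_mul]
    refine ((hasDerivAt_cexp_mul_ofReal _ s).mul
      (hfh.hasDerivAt_integral (hf.locallyIntegrable (by simp)) hU hψ s)).congr_deriv ?_
    rw [Complex.ofReal_zero]
    ring
  have hmain := mul_norm_le_of_hasDerivAt_of_tendsto_atBot
    (M := √((∫ x, R x ∂μ) * ∫ x, W x * ‖ψ x‖ ^ 2 ∂μ)) (half_pos (sub_pos.2 hβ)) hderiv
    (fun s => by
      rw [norm_mul, norm_mul, norm_neg, Complex.norm_I, one_mul, Complex.norm_real,
        Real.norm_of_nonneg (Real.exp_pos _).le]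
      refine (mul_le_mul_of_nonneg_left (hW.norm_integral_mul_comp_flow_le hR hRi hh hψ hU s)
        (Real.exp_pos _).le).trans_eq ?_
      rw [mul_left_comm, ← Real.exp_add]
      ring_nf)
    (tendsto_exp_mul_integral_comp_flow hV hU hf hψ)
  simpa only [flow_zero, mul_zero, Real.exp_zero, Complex.ofReal_one, one_mul] using hmain

theorem IsWeakDeriv.setLIntegral_sq_div_le_of_lt_trace (hfh : IsWeakDeriv μ V 0 U f h)
    (hUo : IsOpen U) (hU : ∀ s, ∀ x ∈ U, flow V s x ∈ U) (hW : IsWeight V U β W)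
    (hβ : β < LinearMap.trace ℝ E V) (hV : 0 < LinearMap.trace ℝ E V) (hf : MemLp f 2 μ)
    (hR : ∀ x, 0 ≤ R x) (hRi : Integrable R μ) (hh : ∀ x, ‖h x‖ ^ 2 ≤ W x * R x) :
    ∫⁻ x in U, ENNReal.ofReal (‖f x‖ ^ 2 / W x) ∂μ ≤
      ENNReal.ofReal ((((LinearMap.trace ℝ E V - β) / 2) ^ 2)⁻¹ * ∫ x, R x ∂μ) := by
  have hκ : 0 < (LinearMap.trace ℝ E V - β) / 2 := half_pos (sub_pos.2 hβ)
  have hR0 : 0 ≤ ∫ x, R x ∂μ := integral_nonneg hR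
  refine setLIntegral_sq_div_le_of_pairing_le hUo hf hW.smooth hW.pos
    (mul_nonneg (inv_nonneg.2 (sq_nonneg _)) hR0) fun ψ hψ => ?_
  have hW0 : 0 ≤ ∫ x, W x * ‖ψ x‖ ^ 2 ∂μ :=
    integral_nonneg fun x => mul_nonneg (hW.nonneg x) (sq_nonneg _)
  have hsq := (Real.le_sqrt (mul_nonneg hκ.le (norm_nonneg _)) (mul_nonneg hR0 hW0)).1
    (hfh.mul_norm_integral_le hf hU hW hβ hV hR hRi hh hψ)
  rwa [mul_pow, ← le_inv_mul_iff₀ (pow_pos hκ 2), ← mul_assoc] at hsq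

end Dilation

section Rotation

variable {E : Type*} [NormedAddCommGroup E] [NormedSpace ℝ E] [FiniteDimensional ℝ E]
  (V : E →L[ℝ] E)

section OrbitIntegral

variable {𝕜 : Type*} [RCLike 𝕜] {k : ℝ → 𝕜} {u : E → 𝕜}

theorem continuous_integral_mul_comp_flow (hk : Continuous k) (hu : Continuous u) (a b : ℝ) :
    Continuous fun x => ∫ s in a..b, k s * u (flow V s x) :=
  intervalIntegral.continuous_parametric_intervalIntegral_of_continuous'
    ((hk.comp continuous_snd).mul (hu.comp ((continuous_flow V).comp continuous_swap))) a b

theorem hasCompactSupport_integral_mul_comp_flow (hu : HasCompactSupport u) (a b : ℝ) :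
    HasCompactSupport fun x => ∫ s in a..b, k s * u (flow V s x) := by
  have hK : IsCompact ((fun p : ℝ × E => flow V p.1 p.2) '' ((-Set.uIcc a b) ×ˢ tsupport u)) :=
    (isCompact_uIcc.neg.prod hu).image (continuous_flow V)
  refine HasCompactSupport.intro hK fun x hx => ?_
  have hzero : Set.EqOn (fun s => k s * u (flow V s x)) 0 (Set.uIcc a b) := fun s hs => by
    have hsx : flow V s x ∉ tsupport u := fun h =>
      hx ⟨(-s, flow V s x), ⟨Set.neg_mem_neg.2 hs, h⟩, flow_neg_flow V s x⟩
    simp only [image_eq_zero_of_notMem_tsupport hsx, mul_zero, Pi.zero_apply]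
  rw [intervalIntegral.integral_congr hzero]
  exact intervalIntegral.integral_zero

end OrbitIntegral

variable [MeasurableSpace E] [BorelSpace E] {μ : Measure E} [μ.IsAddHaarMeasure] {V}
  {U : Set E} {W R : E → ℝ} {f h : E → ℂ} {α m : ℝ}

theorem integral_mul_integral_comp_flow_of_trace_eq_zero (hV : LinearMap.trace ℝ E V = 0)
    (hW : Continuous W) (hWinv : ∀ s x, W (flow V s x) = W x) {u : E → ℝ} (hu : Continuous u)
    (huc : HasCompactSupport u) {b : ℝ} (hb : 0 ≤ b) :
    ∫ x, W x * (∫ s in (0 : ℝ)..b, u (flow V s x)) ∂μ = b * ∫ x, W x * u x ∂μ := by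
  have hfubini := integral_mul_integral_comp_flow V (hW.locallyIntegrable (μ := μ)) hu huc
    (continuous_const (y := (1 : ℝ))) hb
  have hinv (s : ℝ) : ∫ x, W x * u (flow V s x) ∂μ = ∫ x, W x * u x ∂μ := by
    simpa [hWinv, hV] using integral_comp_flow V (fun x => W x * u x) s (μ := μ)
  simp only [one_mul, hinv, intervalIntegral.integral_const, sub_zero, smul_eq_mul] at hfubini
  exact hfubini.symm

theorem mul_integral_weight_orbit_average_le (hV : LinearMap.trace ℝ E V = 0)
    (hW : IsWeight V U 0 W) (hm : ∀ q : ℤ, m ≤ |α - 2 * q| ^ 2) {ψ : E → ℂ} (hψ : Continuous ψ)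
    (hψc : HasCompactSupport ψ) (hper : ∀ x, ψ (flow V Real.pi x) = ψ x) :
    m * ∫ x, W x * ‖∫ s in (0 : ℝ)..Real.pi,
        Complex.exp (-(Complex.I * α) * s) * ψ (flow V s x)‖ ^ 2 ∂μ ≤
      ‖Complex.exp (-(Complex.I * α) * Real.pi) - 1‖ ^ 2 * ∫ x, W x * ‖ψ x‖ ^ 2 ∂μ := by
  set Y : E → ℂ := fun x =>
    ∫ s in (0 : ℝ)..Real.pi, Complex.exp (-(Complex.I * α) * s) * ψ (flow V s x)
  have hYcont : Continuous Y := continuous_integral_mul_comp_flow V (by fun_prop) hψ _ _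
  have hYc : HasCompactSupport Y := hasCompactSupport_integral_mul_comp_flow V hψc _ _
  have hnorm_sq {v : E → ℂ} (hvc : HasCompactSupport v) : HasCompactSupport fun x => ‖v x‖ ^ 2 :=
    hvc.comp_left (g := fun z : ℂ => ‖z‖ ^ 2) (by simp)
  have haverage {v : E → ℂ} (hv : Continuous v) (hvc : HasCompactSupport v) :
      ∫ x, W x * (∫ s in (0 : ℝ)..Real.pi, ‖v (flow V s x)‖ ^ 2) ∂μ =
        Real.pi * ∫ x, W x * ‖v x‖ ^ 2 ∂μ :=
    integral_mul_integral_comp_flow_of_trace_eq_zero hV hW.smooth.continuous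
      (by simpa using hW.homogeneous) (hv.norm.pow 2) (hnorm_sq hvc) Real.pi_pos.le
  have hint {v : E → ℂ} (hv : Continuous v) (hvc : HasCompactSupport v) :
      Integrable (fun x => W x * (∫ s in (0 : ℝ)..Real.pi, ‖v (flow V s x)‖ ^ 2)) μ := by
    have hcont := continuous_integral_mul_comp_flow V (continuous_const (y := (1 : ℝ)))
      (hv.norm.pow 2) 0 Real.pi
    have hsupp := hasCompactSupport_integral_mul_comp_flow V (k := fun _ => (1 : ℝ))
      (hnorm_sq hvc) 0 Real.pi
    simp only [one_mul] at hcont hsupp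
    exact (hW.smooth.continuous.mul hcont).integrable_of_hasCompactSupport
      (hsupp.mul_left (f := W))
  have horbit (x : E) : m * (∫ t in (0 : ℝ)..Real.pi, ‖Y (flow V t x)‖ ^ 2) ≤
      ‖Complex.exp (-(Complex.I * α) * Real.pi) - 1‖ ^ 2 *
        ∫ t in (0 : ℝ)..Real.pi, ‖ψ (flow V t x)‖ ^ 2 := by
    have hcont : Continuous fun t : ℝ => ψ (flow V t x) :=
      hψ.comp ((continuous_flow V).comp (by fun_prop : Continuous fun t : ℝ => (t, x)))
    simpa only [Y, flow_add] using mul_integral_sq_average_le hm hcont fun t => by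
      rw [add_comm, flow_add, hper]
  have hmono := integral_mono ((hint hYcont hYc).const_mul m)
    ((hint hψ hψc).const_mul (‖Complex.exp (-(Complex.I * α) * Real.pi) - 1‖ ^ 2)) fun x => by
      simpa only [mul_left_comm (W x)] using mul_le_mul_of_nonneg_left (horbit x) (hW.nonneg x)
  simp only [integral_const_mul] at hmono
  rw [haverage hYcont hYc, haverage hψ hψc, mul_left_comm, mul_left_comm _ Real.pi] at hmono
  exact le_of_mul_le_mul_left hmono Real.pi_pos

theorem cexp_neg_I_mul_pi_ne_one (hm0 : 0 < m) (hm : ∀ q : ℤ, m ≤ |α - 2 * q| ^ 2) :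
    Complex.exp (-(Complex.I * α) * Real.pi) ≠ 1 := by
  intro hexp
  obtain ⟨n, hn⟩ := Complex.exp_eq_one_iff.1 hexp
  have hpi : (Real.pi : ℂ) * Complex.I ≠ 0 := by simp [Real.pi_ne_zero]
  have hα : (α : ℂ) = 2 * (-n : ℤ) :=
    mul_left_cancel₀ hpi (by push_cast; linear_combination -hn)
  have hα' : α = 2 * (-n : ℤ) := by exact_mod_cast hα
  have hle := hm (-n)
  rw [← hα', sub_self, abs_zero] at hle
  linarith

theorem IsWeakDeriv.cexp_sub_one_mul_integral (hfh : IsWeakDeriv μ V α U f h)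
    (hV : LinearMap.trace ℝ E V = 0) (hU : ∀ s, ∀ x ∈ U, flow V s x ∈ U)
    (hf : LocallyIntegrable f μ) (hh : LocallyIntegrable h μ) {ψ : E → ℂ} (hψ : IsBump U ψ)
    (hper : ∀ x, ψ (flow V Real.pi x) = ψ x) :
    (Complex.exp (-(Complex.I * α) * Real.pi) - 1) * ∫ x, f x * ψ x ∂μ =
      -Complex.I * ∫ x, h x * (∫ s in (0 : ℝ)..Real.pi,
        Complex.exp (-(Complex.I * α) * s) * ψ (flow V s x)) ∂μ := by
  have hderiv (s : ℝ) : HasDerivAt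
      (fun s : ℝ => Complex.exp (-(Complex.I * α) * s) * ∫ x, f x * ψ (flow V s x) ∂μ)
      (-Complex.I * (Complex.exp (-(Complex.I * α) * s) * ∫ x, h x * ψ (flow V s x) ∂μ)) s := by
    refine ((hasDerivAt_cexp_mul_ofReal _ s).mul
      (hfh.hasDerivAt_integral hf hU hψ s)).congr_deriv ?_
    rw [hV, Complex.ofReal_zero]
    ring
  have hcont : Continuous fun s => ∫ x, h x * ψ (flow V s x) ∂μ := continuous_iff_continuousAt.2
    fun s => (hasDerivAt_integral_mul_comp_flow V hh hψ s).continuousAt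
  have hftc := intervalIntegral.integral_eq_sub_of_hasDerivAt (a := 0) (b := Real.pi)
    (fun s _ => hderiv s) (Continuous.intervalIntegrable (by fun_prop) _ _)
  rw [intervalIntegral.integral_const_mul, integral_mul_integral_comp_flow V hh
    hψ.smooth.continuous hψ.compact (by fun_prop) Real.pi_pos.le] at hftc
  simp only [hper, flow_zero, Complex.ofReal_zero, mul_zero, Complex.exp_zero] at hftc
  rw [hftc, sub_mul]

theorem IsWeakDeriv.mul_sq_norm_integral_le_of_invariant (hfh : IsWeakDeriv μ V α U f h)
    (hV : LinearMap.trace ℝ E V = 0) (hU : ∀ s, ∀ x ∈ U, flow V s x ∈ U) (hW : IsWeight V U 0 W)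
    (hf : LocallyIntegrable f μ) (hh : LocallyIntegrable h μ) (hm0 : 0 < m)
    (hm : ∀ q : ℤ, m ≤ |α - 2 * q| ^ 2) (hR : ∀ x, 0 ≤ R x) (hRi : Integrable R μ)
    (hhR : ∀ x, ‖h x‖ ^ 2 ≤ W x * R x) {ψ : E → ℂ} (hψ : IsBump U ψ)
    (hper : ∀ x, ψ (flow V Real.pi x) = ψ x) :
    m * ‖∫ x, f x * ψ x ∂μ‖ ^ 2 ≤ (∫ x, R x ∂μ) * ∫ x, W x * ‖ψ x‖ ^ 2 ∂μ := by
  have hYcont := continuous_integral_mul_comp_flow V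
    (by fun_prop : Continuous fun s : ℝ => Complex.exp (-(Complex.I * α) * s))
    hψ.smooth.continuous 0 Real.pi
  have hYc := hasCompactSupport_integral_mul_comp_flow V
    (k := fun s : ℝ => Complex.exp (-(Complex.I * α) * s)) hψ.compact 0 Real.pi
  have hcs := norm_integral_mul_sq_le hW.nonneg hR hhR hRi
    (integrable_mul_norm_sq hW.smooth.continuous hYcont hYc)
  have hcircle := mul_integral_weight_orbit_average_le (μ := μ) hV hW hm hψ.smooth.continuous
    hψ.compact hper
  have hnorm := congrArg (‖·‖ ^ 2) (hfh.cexp_sub_one_mul_integral hV hU hf hh hψ hper)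
  simp only [norm_mul, norm_neg, Complex.norm_I, one_mul, mul_pow] at hnorm
  have hexp : 0 < ‖Complex.exp (-(Complex.I * α) * Real.pi) - 1‖ ^ 2 :=
    pow_pos (norm_pos_iff.2 (sub_ne_zero.2 (cexp_neg_I_mul_pi_ne_one hm0 hm))) 2
  refine le_of_mul_le_mul_left ?_ hexp
  calc _ = m * ‖∫ x, h x * (∫ s in (0 : ℝ)..Real.pi,
        Complex.exp (-(Complex.I * α) * s) * ψ (flow V s x)) ∂μ‖ ^ 2 := by
        rw [← hnorm, mul_left_comm]
    _ ≤ m * ((∫ x, R x ∂μ) * _) := mul_le_mul_of_nonneg_left hcs hm0.le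
    _ = (∫ x, R x ∂μ) * (m * _) := mul_left_comm _ _ _
    _ ≤ (∫ x, R x ∂μ) * _ := mul_le_mul_of_nonneg_left hcircle (integral_nonneg hR)
    _ = _ := mul_left_comm _ _ _

theorem IsWeight.integral_mul_norm_sq_symmetrization_le (hW : IsWeight V U 0 W)
    (hV : LinearMap.trace ℝ E V = 0) {ψ : E → ℂ} (hψ : IsBump U ψ)
    (hU : ∀ s, ∀ x ∈ U, flow V s x ∈ U) (s : ℝ) :
    ∫ x, W x * ‖1 / 2 * (ψ x + ψ (flow V s x))‖ ^ 2 ∂μ ≤ ∫ x, W x * ‖ψ x‖ ^ 2 ∂μ := by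
  have hint {v : E → ℂ} (hv : IsBump U v) : Integrable (fun x => W x * ‖v x‖ ^ 2) μ :=
    integrable_mul_norm_sq hW.smooth.continuous hv.smooth.continuous hv.compact
  have hψs := hψ.comp_flow V hU s
  have hconvex (z w : ℂ) : ‖1 / 2 * (z + w)‖ ^ 2 ≤ 1 / 2 * (‖z‖ ^ 2 + ‖w‖ ^ 2) := by
    have hparallelogram := parallelogram_law_with_norm ℝ z w
    rw [norm_mul, norm_div, norm_one, RCLike.norm_ofNat]
    nlinarith [sq_nonneg ‖z - w‖]
  calc ∫ x, W x * ‖1 / 2 * (ψ x + ψ (flow V s x))‖ ^ 2 ∂μ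
      ≤ ∫ x, (1 / 2 * (W x * ‖ψ x‖ ^ 2 + W x * ‖ψ (flow V s x)‖ ^ 2)) ∂μ := by
        refine integral_mono (hint ((hψ.add hψs).const_mul (1 / 2)))
          (((hint hψ).add (hint hψs)).const_mul _) fun x => ?_
        simpa only [mul_add, mul_left_comm (W x)] using
          mul_le_mul_of_nonneg_left (hconvex (ψ x) (ψ (flow V s x))) (hW.nonneg x)
    _ = ∫ x, W x * ‖ψ x‖ ^ 2 ∂μ := by
        rw [integral_const_mul, integral_add (hint hψ) (hint hψs),
          hW.integral_mul_norm_sq_comp_flow, hV]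
        simp only [add_zero, zero_mul, neg_zero, Real.exp_zero]
        ring

theorem IsWeakDeriv.setLIntegral_sq_div_le_of_trace_eq_zero (hfh : IsWeakDeriv μ V α U f h)
    (hUo : IsOpen U) (hU : ∀ s, ∀ x ∈ U, flow V s x ∈ U) (hW : IsWeight V U 0 W)
    (hV : LinearMap.trace ℝ E V = 0) (hpi : ∀ x, flow V Real.pi (flow V Real.pi x) = x)
    (hf : MemLp f 2 μ) (hf_inv : ∀ᵐ x ∂μ, f (flow V Real.pi x) = f x)
    (hh : LocallyIntegrable h μ) (hm0 : 0 < m) (hm : ∀ q : ℤ, m ≤ |α - 2 * q| ^ 2)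
    (hR : ∀ x, 0 ≤ R x) (hRi : Integrable R μ) (hhR : ∀ x, ‖h x‖ ^ 2 ≤ W x * R x) :
    ∫⁻ x in U, ENNReal.ofReal (‖f x‖ ^ 2 / W x) ∂μ ≤ ENNReal.ofReal (m⁻¹ * ∫ x, R x ∂μ) := by
  have hR0 : 0 ≤ ∫ x, R x ∂μ := integral_nonneg hR
  have hfloc : LocallyIntegrable f μ := hf.locallyIntegrable (by simp)
  refine setLIntegral_sq_div_le_of_pairing_le hUo hf hW.smooth hW.pos (by positivity)
    fun ψ hψ => ?_
  have hψpi := hψ.comp_flow V hU Real.pi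
  have hinv : ∫ x, f x * ψ (flow V Real.pi x) ∂μ = ∫ x, f x * ψ x ∂μ := by
    have hchange := integral_comp_flow V (fun x => f x * ψ x) Real.pi (μ := μ)
    rw [hV, zero_mul, neg_zero, Real.exp_zero, one_smul] at hchange
    rw [← hchange]
    refine integral_congr_ae ?_
    filter_upwards [hf_inv] with x hx
    rw [hx]
  have hsymm : ∫ x, f x * (1 / 2 * (ψ x + ψ (flow V Real.pi x))) ∂μ = ∫ x, f x * ψ x ∂μ := by
    simp only [mul_left_comm (f _), mul_add (f _)]
    rw [integral_const_mul, integral_add (hψ.integrable_mul hfloc) (hψpi.integrable_mul hfloc),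
      hinv]
    ring
  have hmain := hfh.mul_sq_norm_integral_le_of_invariant hV hU hW hfloc hh hm0 hm hR hRi hhR
    ((hψ.add hψpi).const_mul (1 / 2)) fun x => by rw [hpi, add_comm]
  rw [hsymm] at hmain
  rw [mul_assoc, le_inv_mul_iff₀ hm0]
  exact hmain.trans (mul_le_mul_of_nonneg_left
    (hW.integral_mul_norm_sq_symmetrization_le hV hψ hU Real.pi) hR0)

end Rotation

section Magnetic

variable {N : ℕ}

theorem isOpen_compl_diagonals : IsOpen (diagonals N)ᶜ := by
  have hUnion : diagonals N = ⋃ p : {p : Fin N × Fin N // p.1 ≠ p.2},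
      {x | x p.1.1 = x p.1.2} := by
    ext x
    simp [diagonals]
  rw [hUnion, isOpen_compl_iff]
  exact isClosed_iUnion_of_finite fun p =>
    isClosed_eq (continuous_apply p.1.1) (continuous_apply p.1.2)

theorem contDiffOn_vectorPotential (j : Fin N) (a : Fin 2) :
    ContDiffOn ℝ ∞ (fun x => vectorPotential j x a) (diagonals N)ᶜ := by
  simp only [vectorPotential, WithLp.ofLp_sum, Finset.sum_apply, PiLp.smul_apply, smul_eq_mul]
  refine ContDiffOn.sum fun k hk => ?_
  have hdiff : ContDiff ℝ ∞ fun x : Config N => x j - x k := by fun_prop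
  refine ContDiffOn.mul (ContDiffOn.inv (hdiff.norm_sq ℝ).contDiffOn fun x hx => ?_) ?_
  · have hne : x j ≠ x k := fun h => hx ⟨j, k, (Finset.ne_of_mem_erase hk).symm, h⟩
    exact pow_ne_zero 2 (norm_ne_zero_iff.2 (sub_ne_zero.2 hne))
  · fin_cases a
    · exact ((EuclideanSpace.proj (𝕜 := ℝ) (1 : Fin 2)).contDiff.comp hdiff).neg.contDiffOn
    · exact ((EuclideanSpace.proj (𝕜 := ℝ) (0 : Fin 2)).contDiff.comp hdiff).contDiffOn

/-- The `a`-th coordinate of particle `i`, indexed by the pair `(i, a)`. -/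
noncomputable def coordinate (p : Fin N × Fin 2) : Config N →L[ℝ] ℝ :=
  (EuclideanSpace.proj (𝕜 := ℝ) p.2).comp (ContinuousLinearMap.proj p.1)

/-- The standard basis vector dual to `coordinate p`. -/
noncomputable def basisVector (p : Fin N × Fin 2) : Config N :=
  Pi.single p.1 (EuclideanSpace.single p.2 1)

theorem coordinate_basisVector (p q : Fin N × Fin 2) :
    coordinate p (basisVector q) = if p = q then 1 else 0 := by
  obtain ⟨i, a⟩ := p
  obtain ⟨k, b⟩ := q
  by_cases hik : i = k
  · subst hik
    simp [coordinate, basisVector]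
  · simp [coordinate, basisVector, hik]

theorem sum_coordinate_smul_basisVector (x : Config N) :
    ∑ p, coordinate p x • basisVector p = x := by
  funext i
  ext a
  have hcoordinate : coordinate (i, a) (∑ p, coordinate p x • basisVector p) =
      coordinate (i, a) x := by
    simp [coordinate_basisVector]
  exact hcoordinate

theorem trace_eq_sum_coordinate (V : Config N →L[ℝ] Config N) :
    LinearMap.trace ℝ (Config N) V = ∑ p, coordinate p (V (basisVector p)) := by
  let b : Module.Basis (Fin N × Fin 2) ℝ (Config N) := Module.Basis.ofEquivFun
    { toFun := fun x p => coordinate p x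
      invFun := fun t => ∑ p, t p • basisVector p
      map_add' := fun x y => funext fun p => map_add _ x y
      map_smul' := fun t x => funext fun p => map_smul _ t x
      left_inv := sum_coordinate_smul_basisVector
      right_inv := fun t => funext fun p => by simp [coordinate_basisVector] }
  rw [LinearMap.trace_eq_matrix_trace ℝ b, Matrix.trace]
  refine Finset.sum_congr rfl fun p _ => ?_
  simp [LinearMap.toMatrix_apply, b, Pi.single_apply]

/-- The component `∑ᵢ Vᵢ · Dᵢ φ` of the magnetic gradient `G` along the vector field `V`. -/
noncomputable def derivAlong (V : Config N →L[ℝ] Config N)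
    (G : Fin N → Config N → EuclideanSpace ℂ (Fin 2)) (x : Config N) : ℂ :=
  ∑ p : Fin N × Fin 2, G p.1 x p.2 * (coordinate p (V x) : ℂ)

/-- The component `∑ᵢ Vᵢ · 𝐀ᵢ` of the vector potential along the vector field `V`. -/
noncomputable def potentialAlong (V : Config N →L[ℝ] Config N) (x : Config N) : ℝ :=
  ∑ p : Fin N × Fin 2, vectorPotential p.1 x p.2 * coordinate p (V x)

variable {α c : ℝ} {φ : Config N → ℂ} {G : Fin N → Config N → EuclideanSpace ℂ (Fin 2)}

theorem memLp_component (hG : ∀ j, MemLp (G j) 2 volume) (p : Fin N × Fin 2) :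
    MemLp (fun x => G p.1 x p.2) 2 volume :=
  (EuclideanSpace.proj (𝕜 := ℂ) p.2).comp_memLp' (hG p.1)

theorem partialDeriv_mul (p : Fin N × Fin 2) (T : Config N →L[ℝ] ℝ) {χ : Config N → ℂ}
    (hχ : Differentiable ℝ χ) (x : Config N) :
    partialDeriv p.1 p.2 (fun x => (T x : ℂ) * χ x) x =
      T (basisVector p) * χ x + T x * fderiv ℝ χ x (basisVector p) := by
  have hderiv : fderiv ℝ (fun x => (T x : ℂ) * χ x) x = _ :=
    ((Complex.ofRealCLM.comp T).hasFDerivAt (x := x)).mul (hχ x).hasFDerivAt |>.fderiv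
  rw [partialDeriv, hderiv]
  simp only [ContinuousLinearMap.comp_apply, Complex.ofRealCLM_apply, add_apply, smul_apply,
    smul_eq_mul, basisVector]
  ring

theorem sum_magnetic_term (V : Config N →L[ℝ] Config N) {χ : Config N → ℂ}
    (hχ : Differentiable ℝ χ) (x : Config N) :
    ∑ p : Fin N × Fin 2, (Complex.I *
        partialDeriv p.1 p.2 (fun x => (coordinate p (V x) : ℂ) * χ x) x +
      ((α * vectorPotential p.1 x p.2 : ℝ) : ℂ) * ((coordinate p (V x) : ℂ) * χ x)) =
      Complex.I * fderiv ℝ χ x (V x) +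
        (Complex.I * LinearMap.trace ℝ (Config N) V + (α * potentialAlong V x : ℝ)) * χ x := by
  have hchain : ∑ p, (coordinate p (V x) : ℂ) * fderiv ℝ χ x (basisVector p) =
      fderiv ℝ χ x (V x) := by
    conv_rhs => rw [← sum_coordinate_smul_basisVector (V x)]
    simp only [map_sum, map_smul, Complex.real_smul]
  rw [← hchain, trace_eq_sum_coordinate, potentialAlong]
  push_cast
  simp only [Finset.mul_sum, add_mul, Finset.sum_mul, ← Finset.sum_add_distrib]
  refine Finset.sum_congr rfl fun p _ => ?_
  have hproduct := partialDeriv_mul p ((coordinate p).comp V) hχ x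
  simp only [ContinuousLinearMap.comp_apply] at hproduct
  rw [hproduct]
  ring

theorem integral_derivAlong_mul (hφ : MemLp φ 2 volume) (hG : ∀ j, MemLp (G j) 2 volume)
    (hD : ∀ j, IsMagneticDeriv α j φ (G j)) (V : Config N →L[ℝ] Config N) {χ : Config N → ℂ}
    (hχ : IsBump (diagonals N)ᶜ χ) :
    ∫ x, derivAlong V G x * χ x =
      ∫ x, φ x * (Complex.I * fderiv ℝ χ x (V x) +
        (Complex.I * LinearMap.trace ℝ (Config N) V + (α * potentialAlong V x : ℝ)) * χ x) := by
  have hφloc : LocallyIntegrable φ := hφ.locallyIntegrable (by simp)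
  have hbump (p : Fin N × Fin 2) : IsBump (diagonals N)ᶜ
      fun x => (coordinate p (V x) : ℂ) * χ x :=
    hχ.mul_left isOpen_compl_diagonals
      (Complex.ofRealCLM.comp ((coordinate p).comp V)).contDiff.contDiffOn
  have hpotential (p : Fin N × Fin 2) : ContDiffOn ℝ ∞
      (fun x => ((α * vectorPotential p.1 x p.2 : ℝ) : ℂ)) (diagonals N)ᶜ :=
    Complex.ofRealCLM.contDiff.comp_contDiffOn
      (contDiffOn_const.mul (contDiffOn_vectorPotential p.1 p.2))
  have hleft (p : Fin N × Fin 2) : Integrable fun x =>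
      G p.1 x p.2 * ((coordinate p (V x) : ℂ) * χ x) :=
    (hbump p).integrable_mul ((memLp_component hG p).locallyIntegrable (by simp))
  have hright (p : Fin N × Fin 2) : Integrable fun x => φ x * (Complex.I *
        partialDeriv p.1 p.2 (fun x => (coordinate p (V x) : ℂ) * χ x) x +
      ((α * vectorPotential p.1 x p.2 : ℝ) : ℂ) * ((coordinate p (V x) : ℂ) * χ x)) :=
    ((((hbump p).fderiv_apply contDiff_const).const_mul Complex.I).add
      ((hbump p).mul_left isOpen_compl_diagonals (hpotential p))).integrable_mul hφloc
  calc ∫ x, derivAlong V G x * χ x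
      = ∑ p : Fin N × Fin 2, ∫ x, G p.1 x p.2 * ((coordinate p (V x) : ℂ) * χ x) := by
        rw [← integral_finsetSum _ fun p _ => hleft p]
        simp only [derivAlong, Finset.sum_mul, mul_assoc]
    _ = ∑ p : Fin N × Fin 2, ∫ x, φ x * (Complex.I *
          partialDeriv p.1 p.2 (fun x => (coordinate p (V x) : ℂ) * χ x) x +
        ((α * vectorPotential p.1 x p.2 : ℝ) : ℂ) * ((coordinate p (V x) : ℂ) * χ x)) :=
        Finset.sum_congr rfl fun p _ =>
          hD p.1 _ ⟨(hbump p).smooth, (hbump p).compact, (hbump p).support⟩ p.2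
    _ = _ := by
        rw [← integral_finsetSum _ fun p _ => hright p]
        simp only [← Finset.mul_sum, sum_magnetic_term V (hχ.smooth.differentiable (by simp))]

theorem isWeakDeriv_derivAlong (hφ : MemLp φ 2 volume) (hG : ∀ j, MemLp (G j) 2 volume)
    (hD : ∀ j, IsMagneticDeriv α j φ (G j)) {V : Config N →L[ℝ] Config N} {U : Set (Config N)}
    (hU : IsOpen U) (hUd : U ⊆ (diagonals N)ᶜ) {θ : Config N → ℝ} (hθ : ContDiffOn ℝ ∞ θ U)
    (hgauge : ∀ x ∈ U, α * potentialAlong V x - fderiv ℝ θ x (V x) = c) :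
    IsWeakDeriv volume V c U (fun x => φ x * Complex.exp (Complex.I * θ x))
      (fun x => derivAlong V G x * Complex.exp (Complex.I * θ x)) := by
  intro ψ hψ
  have hphase : ContDiffOn ℝ ∞ (fun x => Complex.exp (Complex.I * θ x)) U :=
    (contDiffOn_const.mul (Complex.ofRealCLM.contDiff.comp_contDiffOn hθ)).cexp
  have hχ := hψ.mul_left hU hphase
  simp only [mul_assoc]
  rw [integral_derivAlong_mul hφ hG hD V ⟨hχ.smooth, hχ.compact, hχ.support.trans hUd⟩]
  congr 1 with x
  by_cases hx : x ∈ U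
  · have hθx := ((hθ x hx).contDiffAt (hU.mem_nhds hx)).differentiableAt (by simp)
    have hexp := ((Complex.ofRealCLM.hasFDerivAt.comp x hθx.hasFDerivAt).const_mul Complex.I).cexp
    have hχ_deriv : fderiv ℝ (fun x => Complex.exp (Complex.I * θ x) * ψ x) x = _ :=
      (hexp.mul (hψ.smooth.differentiable (by simp) x).hasFDerivAt).fderiv
    have hχ_V : fderiv ℝ (fun x => Complex.exp (Complex.I * θ x) * ψ x) x (V x) =
        Complex.exp (Complex.I * θ x) *
          (fderiv ℝ ψ x (V x) + Complex.I * fderiv ℝ θ x (V x) * ψ x) := by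
      rw [hχ_deriv]
      simp only [Function.comp_apply, Complex.ofRealCLM_apply, add_apply, smul_apply, smul_eq_mul,
        ContinuousLinearMap.comp_apply]
      ring
    rw [hχ_V, ← hgauge x hx]
    push_cast
    linear_combination φ x * Complex.exp (Complex.I * θ x) * ψ x * fderiv ℝ θ x (V x) *
      Complex.I_sq
  · rw [hχ.eq_zero_of_notMem hx, (hχ.fderiv_apply V.contDiff).eq_zero_of_notMem hx,
      hψ.eq_zero_of_notMem hx, (hψ.fderiv_apply V.contDiff).eq_zero_of_notMem hx]
    simp only [mul_zero, add_zero]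

end Magnetic

section ComplexPlane

variable {N : ℕ}

/-- The identification `(x, y) ↦ x + i y` of the plane with the complex numbers. -/
noncomputable def toC : Plane ≃ₗᵢ[ℝ] ℂ := Complex.orthonormalBasisOneI.repr.symm

theorem toC_apply (v : Plane) : toC v = v 0 + v 1 * Complex.I :=
  Complex.orthonormalBasisOneI_repr_symm_apply v

theorem toC_symm_mul_single (z : ℂ) (a : Fin 2) :
    toC.symm (z * toC (EuclideanSpace.single a 1)) a = z.re := by
  rw [toC_apply, toC, LinearIsometryEquiv.symm_symm, Complex.orthonormalBasisOneI_repr_apply]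
  fin_cases a <;> simp

theorem sum_perp_mul (u v : Plane) :
    ∑ a, ((‖u‖ ^ 2)⁻¹ • perp u) a * v a = (toC v / toC u).im := by
  have hnorm : Complex.normSq (toC u) = ‖u‖ ^ 2 := by
    rw [Complex.normSq_eq_norm_sq, toC.norm_map]
  rw [Complex.div_im, hnorm]
  simp only [toC_apply, perp, Fin.sum_univ_two, PiLp.smul_apply, Matrix.cons_val_zero,
    Matrix.cons_val_one, Matrix.cons_val_fin_one, smul_eq_mul, Complex.add_re, Complex.add_im,
    Complex.re_ofReal_mul, Complex.im_ofReal_mul, Complex.ofReal_re, Complex.ofReal_im,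
    Complex.I_re, Complex.I_im]
  ring

theorem potentialAlong_eq (V : Config N →L[ℝ] Config N) (x : Config N) :
    potentialAlong V x =
      ∑ i, ∑ k ∈ Finset.univ.erase i, (toC (V x i) / toC (x i - x k)).im := by
  rw [potentialAlong, Fintype.sum_prod_type]
  refine Finset.sum_congr rfl fun i _ => ?_
  simp only [vectorPotential, WithLp.ofLp_sum, Finset.sum_apply, Finset.sum_mul]
  rw [Finset.sum_comm]
  exact Finset.sum_congr rfl fun k _ => sum_perp_mul _ _

theorem norm_derivAlong_sq_le {S : Finset (Fin N)} (V : Config N →L[ℝ] Config N)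
    (G : Fin N → Config N → EuclideanSpace ℂ (Fin 2)) {x : Config N}
    (hV : ∀ i ∉ S, V x i = 0) :
    ‖derivAlong V G x‖ ^ 2 ≤ (∑ i ∈ S, ‖V x i‖ ^ 2) * ∑ i ∈ S, ‖G i x‖ ^ 2 := by
  have hsum : derivAlong V G x =
      ∑ p ∈ S ×ˢ Finset.univ, G p.1 x p.2 * (coordinate p (V x) : ℂ) :=
    (Finset.sum_subset (Finset.subset_univ _) fun p _ hp => by
      have hp_zero : V x p.1 = 0 := hV _ fun h => hp (by simp [h])
      simp [coordinate, hp_zero]).symm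
  have hnorm : ‖derivAlong V G x‖ ≤
      ∑ p ∈ S ×ˢ Finset.univ, |coordinate p (V x)| * ‖G p.1 x p.2‖ := by
    rw [hsum]
    exact norm_sum_le_of_le _ fun p _ => by rw [norm_mul, Complex.norm_real, mul_comm]; rfl
  refine (pow_le_pow_left₀ (norm_nonneg _) hnorm 2).trans
    ((Finset.sum_mul_sq_le_sq_mul_sq _ _ _).trans_eq ?_)
  simp only [EuclideanSpace.norm_sq_eq, Finset.sum_product, Real.norm_eq_abs]
  rfl

end ComplexPlane

section ArgFactor

variable {E : Type*} [NormedAddCommGroup E] [NormedSpace ℝ E]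

/-- The pairs `(z, w)` for which the argument of `1 - z / w` is smooth. -/
def slitPairs : Set (ℂ × ℂ) := {p | p.2 ≠ 0 ∧ 1 - p.1 / p.2 ∈ Complex.slitPlane}

theorem ne_of_mem_slitPairs {z w : ℂ} (h : (z, w) ∈ slitPairs) : z ≠ w := fun hzw => by
  have hslit := h.2
  simp only [hzw, div_self h.1, sub_self] at hslit
  exact Complex.zero_notMem_slitPlane hslit

variable {Z W : E →L[ℝ] ℂ} {x : E}

theorem contDiffAt_arg_one_sub_div (h : (Z x, W x) ∈ slitPairs) :
    ContDiffAt ℝ ∞ (fun y => (1 - Z y / W y).arg) x := by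
  have hfactor : ContDiffAt ℝ ∞ (fun y => 1 - Z y / W y) x := by
    simp only [div_eq_mul_inv]
    exact contDiffAt_const.sub (Z.contDiff.contDiffAt.mul (W.contDiff.contDiffAt.inv h.1))
  have hlog : ContDiffAt ℂ ∞ Complex.log (1 - Z x / W x) := Complex.contDiffAt_log h.2
  simp only [← Complex.log_im]
  exact Complex.imCLM.contDiff.contDiffAt.comp x ((hlog.restrict_scalars ℝ).comp x hfactor)

theorem fderiv_arg_one_sub_div (h : (Z x, W x) ∈ slitPairs) {v : E} (hv : W v = 0) :
    fderiv ℝ (fun y => (1 - Z y / W y).arg) x v = (Z v / (Z x - W x)).im := by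
  have hline : HasDerivAt (fun t : ℝ => x + t • v) v 0 := by
    simpa using ((hasDerivAt_id (0 : ℝ)).smul_const v).const_add x
  have hfactor : HasDerivAt (fun t : ℝ => 1 - Z (x + t • v) / W (x + t • v))
      (-(Z v / W x)) 0 := by
    simp only [map_add, map_smul, hv, smul_zero, add_zero]
    simpa using ((((hasDerivAt_id (0 : ℝ)).smul_const (Z v)).const_add (Z x)).div_const
      (W x)).const_sub 1
  have hslit : 1 - Z (x + (0 : ℝ) • v) / W (x + (0 : ℝ) • v) ∈ Complex.slitPlane := by
    simpa using h.2
  have harg : HasDerivAt (fun t : ℝ => (1 - Z (x + t • v) / W (x + t • v)).arg)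
      (Z v / (Z x - W x)).im 0 := by
    simp only [← Complex.log_im]
    refine (Complex.imCLM.hasFDerivAt.comp_hasDerivAt (0 : ℝ)
      (hfactor.clog_real hslit)).congr_deriv ?_
    have hW : W x ≠ 0 := h.1
    have hsub : W x - Z x ≠ 0 := sub_ne_zero.2 (ne_of_mem_slitPairs h).symm
    rw [Complex.imCLM_apply, zero_smul, add_zero, one_sub_div hW, ← neg_sub (W x)]
    congr 1
    field_simp
  have hcomp := (((contDiffAt_arg_one_sub_div h).differentiableAt (by simp)).hasFDerivAt
    |>.comp_hasDerivAt_of_eq (0 : ℝ) hline (by simp))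
  exact hcomp.unique harg

end ArgFactor

/-- A set of `moving` particles with a `centre`, about which they will be rotated and dilated.
The centre depends linearly on the configuration and does not move with the particles; the
`pinned` particles are fixed particles sitting at the centre. -/
structure Cluster (N : ℕ) where
  moving : Finset (Fin N)
  pinned : Finset (Fin N)
  centre : Config N →L[ℝ] Plane
  disjoint : Disjoint moving pinned
  nontrivial : ∃ i ∈ moving, ∃ k ∈ moving ∪ pinned, i ≠ k
  apply_pinned : ∀ k ∈ pinned, ∀ x, x k = centre x
  centre_motion : ∀ (z : ℂ) (x : Config N),
    centre (fun i => if i ∈ moving then toC.symm (z * toC (x i - centre x)) else 0) = 0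

namespace Cluster

variable {N : ℕ} (C : Cluster N)

/-- The particles which neither move nor sit at the centre. -/
def spectators : Finset (Fin N) := (C.moving ∪ C.pinned)ᶜ

/-- The position of particle `i` relative to the centre, as a complex number. -/
noncomputable def offset (i : Fin N) : Config N →L[ℝ] ℂ :=
  (toC : Plane →L[ℝ] ℂ).comp (ContinuousLinearMap.proj i - C.centre)

/-- The velocity field which multiplies the offsets of the moving particles by `z`. Its flow
dilates the cluster for `z = 1` and rotates it for `z = I`. -/
noncomputable def field (z : ℂ) : Config N →L[ℝ] Config N :=
  ContinuousLinearMap.pi fun i =>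
    if i ∈ C.moving then (toC.symm : ℂ →L[ℝ] Plane).comp (z • C.offset i) else 0

theorem offset_apply (i : Fin N) (x : Config N) : C.offset i x = toC (x i - C.centre x) := rfl

theorem offset_sub_offset (i k : Fin N) (x : Config N) :
    C.offset i x - C.offset k x = toC (x i - x k) := by
  rw [offset_apply, offset_apply, ← map_sub, sub_sub_sub_cancel_right]

theorem offset_eq_offset_iff {i k : Fin N} {x : Config N} :
    C.offset i x = C.offset k x ↔ x i = x k := by
  rw [← sub_eq_zero, offset_sub_offset, toC.map_eq_zero_iff, sub_eq_zero]

theorem offset_of_mem_pinned {k : Fin N} (hk : k ∈ C.pinned) (x : Config N) :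
    C.offset k x = 0 := by
  rw [offset_apply, C.apply_pinned k hk x, sub_self, map_zero]

theorem notMem_moving_of_mem_spectators {k : Fin N} (hk : k ∈ C.spectators) : k ∉ C.moving :=
  fun h => Finset.mem_compl.1 hk (Finset.mem_union_left _ h)

theorem field_apply_of_mem (z : ℂ) {i : Fin N} (hi : i ∈ C.moving) (x : Config N) :
    C.field z x i = toC.symm (z * C.offset i x) := by
  simp [field, hi]

theorem field_apply_of_notMem (z : ℂ) {i : Fin N} (hi : i ∉ C.moving) (x : Config N) :
    C.field z x i = 0 := by
  simp [field, hi]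

theorem toC_field_apply (z : ℂ) {i : Fin N} (hi : i ∈ C.moving) (x : Config N) :
    toC (C.field z x i) = z * C.offset i x := by
  rw [field_apply_of_mem C z hi, LinearIsometryEquiv.apply_symm_apply]

theorem centre_field (z : ℂ) (x : Config N) : C.centre (C.field z x) = 0 := by
  rw [← C.centre_motion z x]
  congr 1
  funext i
  split_ifs with hi
  · exact C.field_apply_of_mem z hi x
  · exact C.field_apply_of_notMem z hi x

theorem offset_field (z : ℂ) {i : Fin N} (hi : i ∈ C.moving) (x : Config N) :
    C.offset i (C.field z x) = z * C.offset i x := by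
  rw [offset_apply, centre_field, sub_zero, toC_field_apply C z hi]

theorem offset_field_of_notMem (z : ℂ) {i : Fin N} (hi : i ∉ C.moving) (x : Config N) :
    C.offset i (C.field z x) = 0 := by
  rw [offset_apply, centre_field, field_apply_of_notMem C z hi, sub_zero, map_zero]

theorem offset_flow (z : ℂ) {i : Fin N} (hi : i ∈ C.moving) (s : ℝ) (x : Config N) :
    C.offset i (flow (C.field z) s x) = Complex.exp (z * s) * C.offset i x :=
  apply_flow_of_eigen _ (C.offset_field z hi) s x

theorem offset_flow_of_notMem (z : ℂ) {i : Fin N} (hi : i ∉ C.moving) (s : ℝ) (x : Config N) :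
    C.offset i (flow (C.field z) s x) = C.offset i x := by
  simpa using apply_flow_of_eigen (c := 0) _
    (fun x => by rw [C.offset_field_of_notMem z hi, zero_mul]) s x

theorem centre_flow (z : ℂ) (s : ℝ) (x : Config N) :
    C.centre (flow (C.field z) s x) = C.centre x := by
  have hfixed := apply_flow_of_eigen (c := 0) (T := (toC : Plane →L[ℝ] ℂ).comp C.centre) (C.field z)
    (fun x => by simp [centre_field]) s x
  simpa using hfixed

theorem apply_eq_centre_add (x : Config N) (i : Fin N) :
    x i = C.centre x + toC.symm (C.offset i x) := by
  rw [offset_apply, LinearIsometryEquiv.symm_apply_apply, add_sub_cancel]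

theorem ext_offset {x y : Config N} (hcentre : C.centre x = C.centre y)
    (hoffset : ∀ i, C.offset i x = C.offset i y) : x = y :=
  funext fun i => by rw [C.apply_eq_centre_add x, C.apply_eq_centre_add y, hcentre, hoffset]

/-- The configurations off the diagonals for which the offset `z` of every moving particle and the
offset `w` of every spectator satisfy `(z, w) ∈ Ω`. -/
def region (Ω : Set (ℂ × ℂ)) : Set (Config N) :=
  {x | x ∉ diagonals N ∧ ∀ i ∈ C.moving, ∀ k ∈ C.spectators, (C.offset i x, C.offset k x) ∈ Ω}

variable {Ω : Set (ℂ × ℂ)} {x : Config N}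

theorem isOpen_region (hΩ : IsOpen Ω) : IsOpen (C.region Ω) := by
  have hInter : C.region Ω = (diagonals N)ᶜ ∩ ⋂ i ∈ C.moving, ⋂ k ∈ C.spectators,
      (fun x => (C.offset i x, C.offset k x)) ⁻¹' Ω := by
    ext x
    simp [region]
  rw [hInter]
  exact isOpen_compl_diagonals.inter (isOpen_biInter_finset fun i _ =>
    isOpen_biInter_finset fun k _ => hΩ.preimage (by fun_prop))

theorem flow_mem_region {z : ℂ} (hΩ : ∀ (s : ℝ) (p : ℂ × ℂ), p ∈ Ω →
    (Complex.exp (z * s) * p.1, p.2) ∈ Ω) (hΩ_slit : Ω ⊆ slitPairs) (s : ℝ)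
    (hx : x ∈ C.region Ω) : flow (C.field z) s x ∈ C.region Ω := by
  have hflow : ∀ i ∈ C.moving, ∀ k ∈ C.spectators,
      (C.offset i (flow (C.field z) s x), C.offset k (flow (C.field z) s x)) ∈ Ω := by
    intro i hi k hk
    rw [C.offset_flow z hi, C.offset_flow_of_notMem z (C.notMem_moving_of_mem_spectators hk)]
    exact hΩ s _ (hx.2 i hi k hk)
  have hne {i k : Fin N} (hik : i ≠ k) : C.offset i x ≠ C.offset k x := fun h =>
    hx.1 ⟨i, k, hik, C.offset_eq_offset_iff.1 h⟩
  have hmixed {i k : Fin N} (hi : i ∈ C.moving) (hk : k ∉ C.moving) :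
      C.offset i (flow (C.field z) s x) ≠ C.offset k (flow (C.field z) s x) := by
    by_cases hk_pinned : k ∈ C.pinned
    · have hoffset := hne (ne_of_mem_of_not_mem hi hk)
      rw [C.offset_of_mem_pinned hk_pinned] at hoffset ⊢
      rw [C.offset_flow z hi]
      exact mul_ne_zero (Complex.exp_ne_zero _) hoffset
    · exact ne_of_mem_slitPairs (hΩ_slit (hflow i hi k (by simp [spectators, hk, hk_pinned])))
  refine ⟨?_, hflow⟩
  rintro ⟨i, k, hik, h⟩
  rw [← C.offset_eq_offset_iff] at h
  by_cases hi : i ∈ C.moving <;> by_cases hk : k ∈ C.moving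
  · rw [C.offset_flow z hi, C.offset_flow z hk] at h
    exact hne hik (mul_left_cancel₀ (Complex.exp_ne_zero _) h)
  · exact hmixed hi hk h
  · exact hmixed hk hi h.symm
  · rw [C.offset_flow_of_notMem z hi, C.offset_flow_of_notMem z hk] at h
    exact hne hik h

/-- Up to the factor `-α`, the phase that removes the spectators from the vector potential along
`field z`: the offset `w` of a spectator enters through the argument of `w - z`, normalised to
`1 - z / w` so that it is single valued as long as `(z, w)` stays in `slitPairs`. -/
noncomputable def angle (x : Config N) : ℝ :=
  ∑ i ∈ C.moving, ∑ k ∈ C.spectators, (1 - C.offset i x / C.offset k x).arg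

/-- The number of pairs of particles whose relative position turns with the full speed of
`field I`. -/
def turningPairs : ℕ := C.moving.card.choose 2 + C.moving.card * C.pinned.card

theorem contDiffOn_angle (hΩ : Ω ⊆ slitPairs) : ContDiffOn ℝ ∞ C.angle (C.region Ω) :=
  fun _ hx => (ContDiffAt.sum fun i hi => ContDiffAt.sum fun k hk =>
    contDiffAt_arg_one_sub_div (hΩ (hx.2 i hi k hk))).contDiffWithinAt

theorem fderiv_angle (hΩ : Ω ⊆ slitPairs) (hx : x ∈ C.region Ω) (z : ℂ) :
    fderiv ℝ C.angle x (C.field z x) = ∑ i ∈ C.moving, ∑ k ∈ C.spectators,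
      (z * C.offset i x / (C.offset i x - C.offset k x)).im := by
  have hdiff : ∀ i ∈ C.moving, ∀ k ∈ C.spectators,
      DifferentiableAt ℝ (fun y => (1 - C.offset i y / C.offset k y).arg) x := fun i hi k hk =>
    (contDiffAt_arg_one_sub_div (hΩ (hx.2 i hi k hk))).differentiableAt (by simp)
  unfold angle
  rw [fderiv_fun_sum fun i hi => DifferentiableAt.fun_sum fun k hk => hdiff i hi k hk, sum_apply]
  refine Finset.sum_congr rfl fun i hi => ?_
  rw [fderiv_fun_sum fun k hk => hdiff i hi k hk, sum_apply]
  refine Finset.sum_congr rfl fun k hk => ?_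
  rw [fderiv_arg_one_sub_div (hΩ (hx.2 i hi k hk))
    (C.offset_field_of_notMem z (C.notMem_moving_of_mem_spectators hk) x), C.offset_field z hi]

theorem sum_moving_im_div {z : ℂ} (hx : x ∉ diagonals N) :
    ∑ i ∈ C.moving, ∑ k ∈ C.moving.erase i,
      (z * C.offset i x / (C.offset i x - C.offset k x)).im = C.moving.card.choose 2 * z.im := by
  set S := C.moving
  set term : Fin N → Fin N → ℝ := fun i k =>
    (z * C.offset i x / (C.offset i x - C.offset k x)).im
  have hpair (i k : Fin N) (hk : k ∈ S.erase i) : term i k + term k i = z.im := by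
    have hne : C.offset i x - C.offset k x ≠ 0 := sub_ne_zero.2 fun h =>
      hx ⟨i, k, (Finset.ne_of_mem_erase hk).symm, C.offset_eq_offset_iff.1 h⟩
    simp only [term]
    rw [← Complex.add_im, ← neg_sub (C.offset i x) (C.offset k x), div_neg, ← sub_eq_add_neg,
      ← sub_div, ← mul_sub, mul_div_cancel_right₀ _ hne]
  have hswap : ∑ i ∈ S, ∑ k ∈ S.erase i, term k i = ∑ i ∈ S, ∑ k ∈ S.erase i, term i k :=
    Finset.sum_comm' fun i k => by
      simp only [Finset.mem_erase]
      tauto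
  have htwice : ∑ i ∈ S, ∑ k ∈ S.erase i, (term i k + term k i) =
      S.card * (S.card - 1) * z.im := by
    rw [Finset.sum_congr rfl fun i hi => (Finset.sum_congr rfl (hpair i)).trans
      (by rw [Finset.sum_const, Finset.card_erase_of_mem hi, nsmul_eq_mul,
        Nat.cast_pred (Finset.card_pos.2 ⟨i, hi⟩)]), Finset.sum_const, nsmul_eq_mul, mul_assoc]
  simp only [Finset.sum_add_distrib, hswap] at htwice
  rw [Nat.cast_choose_two]
  linarith

theorem sum_pinned_im_div (hx : x ∉ diagonals N) (z : ℂ) {i : Fin N} (hi : i ∈ C.moving) :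
    ∑ k ∈ C.pinned, (z * C.offset i x / (C.offset i x - C.offset k x)).im =
      C.pinned.card * z.im := by
  rw [← nsmul_eq_mul]
  refine Finset.sum_eq_card_nsmul fun k hk => ?_
  have hne : C.offset i x ≠ 0 := fun h => hx ⟨i, k, fun hik =>
    Finset.disjoint_left.1 C.disjoint hi (hik ▸ hk), C.offset_eq_offset_iff.1
      (h.trans (C.offset_of_mem_pinned hk x).symm)⟩
  rw [C.offset_of_mem_pinned hk, sub_zero, mul_div_cancel_right₀ _ hne]

theorem potentialAlong_field (hx : x ∉ diagonals N) (z : ℂ) :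
    potentialAlong (C.field z) x = C.turningPairs * z.im +
      ∑ i ∈ C.moving, ∑ k ∈ C.spectators,
        (z * C.offset i x / (C.offset i x - C.offset k x)).im := by
  have hsplit : ∀ i ∈ C.moving,
      Finset.univ.erase i = (C.moving.erase i ∪ C.pinned) ∪ C.spectators := by
    intro i hi
    have hi_pinned := Finset.disjoint_left.1 C.disjoint hi
    ext k
    simp only [spectators, Finset.mem_erase, Finset.mem_union, Finset.mem_compl, Finset.mem_univ]
    grind
  have hdisjoint (i : Fin N) : Disjoint (C.moving.erase i ∪ C.pinned) C.spectators :=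
    disjoint_compl_right.mono_left
      (Finset.union_subset_union_left (Finset.erase_subset _ _))
  rw [potentialAlong_eq, ← Finset.sum_subset (Finset.subset_univ C.moving) fun i _ hi => by
    simp [C.field_apply_of_notMem z hi]]
  simp only [← C.offset_sub_offset]
  rw [Finset.sum_congr rfl fun i hi => by
    rw [hsplit i hi, Finset.sum_union (hdisjoint i),
      Finset.sum_union (C.disjoint.mono_left (Finset.erase_subset _ _)), C.toC_field_apply z hi,
      C.sum_pinned_im_div hx z hi],
    Finset.sum_add_distrib, Finset.sum_add_distrib, C.sum_moving_im_div hx, Finset.sum_const,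
    nsmul_eq_mul, turningPairs]
  push_cast
  ring

/-- The moment of inertia of the moving particles about the centre. -/
noncomputable def inertia (x : Config N) : ℝ := ∑ i ∈ C.moving, ‖C.offset i x‖ ^ 2

theorem inertia_pos (hx : x ∉ diagonals N) : 0 < C.inertia x := by
  obtain ⟨i, hi, k, hk, hik⟩ := C.nontrivial
  have hne : C.offset i x ≠ C.offset k x := fun h =>
    hx ⟨i, k, hik, C.offset_eq_offset_iff.1 h⟩
  obtain ⟨n, hn, hn0⟩ : ∃ n ∈ C.moving, C.offset n x ≠ 0 := by
    rcases Finset.mem_union.1 hk with hk | hk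
    · by_cases hi0 : C.offset i x = 0
      · exact ⟨k, hk, fun h => hne (hi0.trans h.symm)⟩
      · exact ⟨i, hi, hi0⟩
    · exact ⟨i, hi, fun h => hne (h.trans (C.offset_of_mem_pinned hk x).symm)⟩
  exact Finset.sum_pos' (fun _ _ => sq_nonneg _) ⟨n, hn, pow_pos (norm_pos_iff.2 hn0) 2⟩

theorem isWeight_inertia (z : ℂ) (Ω : Set (ℂ × ℂ)) :
    IsWeight (C.field z) (C.region Ω) (2 * z.re) C.inertia where
  smooth := ContDiff.sum fun i _ => (C.offset i).contDiff.norm_sq ℝ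
  nonneg _ := Finset.sum_nonneg fun _ _ => sq_nonneg _
  pos _ hx := C.inertia_pos hx.1
  homogeneous s x := by
    rw [inertia, inertia, Finset.mul_sum]
    refine Finset.sum_congr rfl fun i hi => ?_
    rw [C.offset_flow z hi, norm_mul, mul_pow, Complex.norm_exp, Complex.re_mul_ofReal,
      ← Real.exp_nat_mul, mul_assoc]
    norm_num

theorem norm_derivAlong_field_sq_le {z : ℂ} (hz : ‖z‖ = 1)
    (G : Fin N → Config N → EuclideanSpace ℂ (Fin 2)) (x : Config N) :
    ‖derivAlong (C.field z) G x‖ ^ 2 ≤ C.inertia x * ∑ i ∈ C.moving, ‖G i x‖ ^ 2 := by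
  refine (norm_derivAlong_sq_le _ G fun i hi => C.field_apply_of_notMem z hi x).trans_eq ?_
  congr 1
  refine Finset.sum_congr rfl fun i hi => ?_
  rw [← toC.norm_map, C.toC_field_apply z hi, norm_mul, hz, one_mul]

end Cluster

namespace Cluster

variable {N : ℕ} (C : Cluster N) {Ω : Set (ℂ × ℂ)} {α : ℝ} {φ : Config N → ℂ}
  {G : Fin N → Config N → EuclideanSpace ℂ (Fin 2)}

/-- The gauge factor that removes the spectators from the vector potential of the cluster. -/
noncomputable def phase (α : ℝ) (x : Config N) : ℂ :=
  Complex.exp (Complex.I * (α * C.angle x : ℝ))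

theorem norm_phase (α : ℝ) (x : Config N) : ‖C.phase α x‖ = 1 := by
  rw [phase, mul_comm, Complex.norm_exp_ofReal_mul_I]

theorem measurable_phase (α : ℝ) : Measurable (C.phase α) := by
  have hangle : Measurable C.angle := Finset.measurable_sum _ fun i _ =>
    Finset.measurable_sum _ fun k _ => Complex.measurable_arg.comp (by fun_prop)
  unfold phase
  fun_prop

theorem memLp_mul_phase (hφ : MemLp φ 2 volume) :
    MemLp (fun x => φ x * C.phase α x) 2 volume :=
  hφ.of_le (hφ.aestronglyMeasurable.mul (C.measurable_phase α).aestronglyMeasurable)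
    (.of_forall fun x => by rw [norm_mul, C.norm_phase, mul_one])

theorem locallyIntegrable_derivAlong_mul_phase (hG : ∀ j, MemLp (G j) 2 volume)
    (V : Config N →L[ℝ] Config N) :
    LocallyIntegrable (fun x => derivAlong V G x * C.phase α x) := by
  simp only [derivAlong, Finset.sum_mul, mul_right_comm _ (_ : ℂ) (C.phase α _)]
  exact locallyIntegrable_finsetSum _ fun p _ => LocallyIntegrable.mul_continuous (by fun_prop)
    ((C.memLp_mul_phase (memLp_component hG p)).locallyIntegrable (by simp))

theorem isWeakDeriv_mul_phase (hφ : MemLp φ 2 volume) (hG : ∀ j, MemLp (G j) 2 volume)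
    (hD : ∀ j, IsMagneticDeriv α j φ (G j)) (hΩo : IsOpen Ω) (hΩ : Ω ⊆ slitPairs) (z : ℂ) :
    IsWeakDeriv volume (C.field z) (α * C.turningPairs * z.im) (C.region Ω)
      (fun x => φ x * C.phase α x) (fun x => derivAlong (C.field z) G x * C.phase α x) := by
  refine isWeakDeriv_derivAlong hφ hG hD (C.isOpen_region hΩo) (fun x hx => hx.1)
    (contDiffOn_const.mul (C.contDiffOn_angle hΩ)) fun x hx => ?_
  have hangle : DifferentiableAt ℝ C.angle x :=
    ((C.contDiffOn_angle hΩ x hx).contDiffAt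
      ((C.isOpen_region hΩo).mem_nhds hx)).differentiableAt (by simp)
  rw [C.potentialAlong_field hx.1, fderiv_const_mul hangle, smul_apply, C.fderiv_angle hΩ hx,
    smul_eq_mul]
  ring

theorem norm_derivAlong_mul_phase_sq_le {z : ℂ} (hz : ‖z‖ = 1) (x : Config N) :
    ‖derivAlong (C.field z) G x * C.phase α x‖ ^ 2 ≤
      C.inertia x * ∑ i ∈ C.moving, ‖G i x‖ ^ 2 := by
  rw [norm_mul, C.norm_phase, mul_one]
  exact C.norm_derivAlong_field_sq_le hz G x

theorem integrable_sum_norm_sq (hG : ∀ j, MemLp (G j) 2 volume) (S : Finset (Fin N)) :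
    Integrable fun x => ∑ i ∈ S, ‖G i x‖ ^ 2 :=
  integrable_finsetSum _ fun i _ => (hG i).integrable_norm_pow two_ne_zero

theorem setLIntegral_sq_div_inertia_le_of_dilation (hφ : MemLp φ 2 volume)
    (hG : ∀ j, MemLp (G j) 2 volume) (hD : ∀ j, IsMagneticDeriv α j φ (G j)) (hΩo : IsOpen Ω)
    (hΩ : Ω ⊆ slitPairs)
    (hΩ_dil : ∀ (s : ℝ) (p : ℂ × ℂ), p ∈ Ω → (Complex.exp (1 * s) * p.1, p.2) ∈ Ω)
    (htrace : 2 < LinearMap.trace ℝ (Config N) (C.field 1)) :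
    ∫⁻ x in C.region Ω, ENNReal.ofReal (‖φ x‖ ^ 2 / C.inertia x) ≤
      ENNReal.ofReal ((((LinearMap.trace ℝ (Config N) (C.field 1) - 2) / 2) ^ 2)⁻¹ *
        ∫ x, ∑ i ∈ C.moving, ‖G i x‖ ^ 2) := by
  have hderiv := C.isWeakDeriv_mul_phase hφ hG hD hΩo hΩ 1
  have hweight := C.isWeight_inertia 1 Ω
  rw [Complex.one_im, mul_zero] at hderiv
  rw [Complex.one_re, mul_one] at hweight
  simpa only [norm_mul, C.norm_phase, mul_one] using
    hderiv.setLIntegral_sq_div_le_of_lt_trace (C.isOpen_region hΩo)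
      (fun s _ hx => C.flow_mem_region hΩ_dil hΩ s hx) hweight htrace (two_pos.trans htrace)
      (C.memLp_mul_phase hφ) (fun x => Finset.sum_nonneg fun i _ => sq_nonneg _)
      (integrable_sum_norm_sq hG _) (C.norm_derivAlong_mul_phase_sq_le norm_one)

theorem flow_field_I_pi (x : Config N) :
    flow (C.field Complex.I) Real.pi (flow (C.field Complex.I) Real.pi x) = x := by
  refine C.ext_offset (by simp only [centre_flow]) fun i => ?_
  by_cases hi : i ∈ C.moving
  · rw [C.offset_flow _ hi, C.offset_flow _ hi, mul_comm Complex.I, Complex.exp_pi_mul_I]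
    ring
  · simp only [C.offset_flow_of_notMem _ hi]

variable {σ : Equiv.Perm (Fin N)}

theorem angle_comp_perm (hσ : ∀ i, σ i ∈ C.moving ↔ i ∈ C.moving)
    (hσ_flow : ∀ x, flow (C.field Complex.I) Real.pi x = x ∘ σ) (x : Config N) :
    C.angle (x ∘ σ) = C.angle x := by
  have hoffset (i : Fin N) : C.offset i (x ∘ σ) = C.offset (σ i) x := by
    rw [offset_apply, ← hσ_flow, centre_flow, hσ_flow]
    rfl
  have hspectator : ∀ k ∈ C.spectators, C.offset k (x ∘ σ) = C.offset k x := fun k hk => by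
    rw [← hσ_flow, C.offset_flow_of_notMem _ (C.notMem_moving_of_mem_spectators hk)]
  refine Finset.sum_equiv σ (fun i => (hσ i).symm) fun i _ => ?_
  exact Finset.sum_congr rfl fun k hk => by rw [hspectator k hk, hoffset]

theorem setLIntegral_sq_div_inertia_le_of_rotation (hφ : IsSymmetricL2 φ)
    (hG : ∀ j, MemLp (G j) 2 volume) (hD : ∀ j, IsMagneticDeriv α j φ (G j)) (hΩo : IsOpen Ω)
    (hΩ : Ω ⊆ slitPairs)
    (hΩ_rot : ∀ (s : ℝ) (p : ℂ × ℂ), p ∈ Ω → (Complex.exp (Complex.I * s) * p.1, p.2) ∈ Ω)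
    (htrace : LinearMap.trace ℝ (Config N) (C.field Complex.I) = 0)
    (hσ : ∀ i, σ i ∈ C.moving ↔ i ∈ C.moving)
    (hσ_flow : ∀ x, flow (C.field Complex.I) Real.pi x = x ∘ σ) {m : ℝ} (hm0 : 0 < m)
    (hm : ∀ q : ℤ, m ≤ |α * C.turningPairs - 2 * q| ^ 2) :
    ∫⁻ x in C.region Ω, ENNReal.ofReal (‖φ x‖ ^ 2 / C.inertia x) ≤
      ENNReal.ofReal (m⁻¹ * ∫ x, ∑ i ∈ C.moving, ‖G i x‖ ^ 2) := by
  have hderiv := C.isWeakDeriv_mul_phase hφ.memLp hG hD hΩo hΩ Complex.I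
  have hweight := C.isWeight_inertia Complex.I Ω
  rw [Complex.I_im, mul_one] at hderiv
  rw [Complex.I_re, mul_zero] at hweight
  have hinv : ∀ᵐ x, φ (flow (C.field Complex.I) Real.pi x) *
      C.phase α (flow (C.field Complex.I) Real.pi x) = φ x * C.phase α x := by
    filter_upwards [hφ.symm σ] with x hx
    rw [hσ_flow, phase, phase, C.angle_comp_perm hσ hσ_flow, hx]
  simpa only [norm_mul, C.norm_phase, mul_one] using
    hderiv.setLIntegral_sq_div_le_of_trace_eq_zero (C.isOpen_region hΩo)
      (fun s _ hx => C.flow_mem_region hΩ_rot hΩ s hx) hweight htrace C.flow_field_I_pi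
      (C.memLp_mul_phase hφ.memLp) hinv
      (C.locallyIntegrable_derivAlong_mul_phase hG _) hm0 hm
      (fun x => Finset.sum_nonneg fun i _ => sq_nonneg _)
      (integrable_sum_norm_sq hG _)
      (C.norm_derivAlong_mul_phase_sq_le Complex.norm_I)

end Cluster

section NullSets

variable {N : ℕ}

theorem ae_ne_zero_of_polynomial_on_lines {E : Type*} [NormedAddCommGroup E] [NormedSpace ℝ E]
    [FiniteDimensional ℝ E] [MeasurableSpace E] [BorelSpace E] (μ : Measure E) [μ.IsAddHaarMeasure]
    {f : E → ℝ} (hf : Continuous f) (v : E)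
    (hp : ∀ y, ∃ p : Polynomial ℝ, p ≠ 0 ∧ ∀ t : ℝ, f (y + t • v) = p.eval t) :
    ∀ᵐ x ∂μ, f x ≠ 0 := by
  refine ae_mem_of_ae_add_linearMap_mem (s := {x | f x ≠ 0}) (LinearMap.toSpanSingleton ℝ E v)
    volume μ (isOpen_ne_fun hf continuous_const).measurableSet fun y => ?_
  obtain ⟨p, hp0, hpf⟩ := hp y
  refine ((Polynomial.finite_setOfPred_isRoot hp0).countable.ae_notMem volume).mono
    fun t ht h => ht ?_
  exact (hpf t).symm.trans h

theorem ae_notMem_diagonals : ∀ᵐ x : Config N, x ∉ diagonals N := by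
  have hne (j l : Fin N) (hjl : j ≠ l) :
      ∀ᵐ x : Config N, coordinate (j, 0) x - coordinate (l, 0) x ≠ 0 := by
    refine ae_ne_zero_of_polynomial_on_lines volume (by fun_prop) (basisVector (j, 0)) fun y =>
      ⟨_, Polynomial.X_add_C_ne_zero (coordinate (j, 0) y - coordinate (l, 0) y), fun t => ?_⟩
    simp only [map_add, map_smul, coordinate_basisVector, Prod.mk.injEq, hjl.symm, false_and,
      if_true, if_false, smul_eq_mul, Polynomial.eval_add, Polynomial.eval_X, Polynomial.eval_C]
    ring
  have hne_all : ∀ᵐ x : Config N, ∀ j l : Fin N, j ≠ l →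
      coordinate (j, 0) x - coordinate (l, 0) x ≠ 0 :=
    ae_all_iff.2 fun j => ae_all_iff.2 fun l => Filter.eventually_imp_distrib_left.2 (hne j l)
  filter_upwards [hne_all] with x hx
  rintro ⟨j, l, hjl, h⟩
  exact hx j l hjl (sub_eq_zero.2 (congrArg (· 0) h))

end NullSets

namespace Cluster

variable {N : ℕ} (C : Cluster N)

theorem coordinate_field_basisVector (z : ℂ) {i : Fin N} (hi : i ∈ C.moving) (a : Fin 2) {c : ℝ}
    (hc : C.centre (basisVector (i, a)) = c • EuclideanSpace.single a 1) :
    coordinate (i, a) (C.field z (basisVector (i, a))) = (1 - c) * z.re := by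
  have hoffset : C.offset i (basisVector (i, a)) =
      (1 - c) • toC (EuclideanSpace.single a 1) := by
    rw [offset_apply, hc, ← map_smul, sub_smul, one_smul, basisVector, Pi.single_eq_same]
  change C.field z (basisVector (i, a)) i a = _
  rw [C.field_apply_of_mem z hi, hoffset, mul_smul_comm, map_smul, PiLp.smul_apply,
    toC_symm_mul_single, smul_eq_mul]

theorem trace_field (z : ℂ) {c : ℝ} (hc : ∀ i ∈ C.moving, ∀ a,
    C.centre (basisVector (i, a)) = c • EuclideanSpace.single a 1) :
    LinearMap.trace ℝ (Config N) (C.field z) = 2 * C.moving.card * (1 - c) * z.re := by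
  have hmoving : ∀ i ∈ C.moving,
      ∑ a, coordinate (i, a) (C.field z (basisVector (i, a))) = 2 * (1 - c) * z.re := by
    intro i hi
    rw [Finset.sum_congr rfl fun a _ => C.coordinate_field_basisVector z hi a (hc i hi a),
      Fin.sum_const, nsmul_eq_mul, Nat.cast_ofNat, mul_assoc]
  have hrest : ∀ i ∉ C.moving, ∑ a, coordinate (i, a) (C.field z (basisVector (i, a))) = 0 :=
    fun i hi => Finset.sum_eq_zero fun a _ => by
      change C.field z (basisVector (i, a)) i a = 0
      rw [C.field_apply_of_notMem z hi, PiLp.zero_apply]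
  rw [trace_eq_sum_coordinate, Fintype.sum_prod_type,
    ← Finset.sum_subset (Finset.subset_univ _) fun i _ hi => hrest i hi,
    Finset.sum_congr rfl hmoving, Finset.sum_const, nsmul_eq_mul]
  ring

end Cluster

namespace Cluster

variable {N : ℕ} {α : ℝ} {φ : Config N → ℂ} {G : Fin N → Config N → EuclideanSpace ℂ (Fin 2)}
  {j k l : Fin N} {x : Config N}

/-- The particles `j` and `l`, turning about their midpoint. -/
noncomputable def pair (hjl : j ≠ l) : Cluster N where
  moving := {j, l}
  pinned := ∅
  centre := (2⁻¹ : ℝ) •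
    ((ContinuousLinearMap.proj j : Config N →L[ℝ] Plane) + ContinuousLinearMap.proj l)
  disjoint := Finset.disjoint_empty_right _
  nontrivial := ⟨j, by simp, l, by simp, hjl⟩
  apply_pinned _ hk := absurd hk (Finset.notMem_empty _)
  centre_motion z x := by
    set c : Plane := (2⁻¹ : ℝ) • (x j + x l)
    have hzero : x j - c + (x l - c) = 0 := by
      module
    change (2⁻¹ : ℝ) • ((if j ∈ {j, l} then toC.symm (z * toC (x j - c)) else 0) +
      if l ∈ {j, l} then toC.symm (z * toC (x l - c)) else 0) = 0
    rw [if_pos (by simp), if_pos (by simp), ← map_add, ← mul_add, ← map_add, hzero, map_zero,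
      mul_zero, map_zero, smul_zero]

theorem pair_centre_apply (hjl : j ≠ l) (x : Config N) :
    (pair hjl).centre x = (2⁻¹ : ℝ) • (x j + x l) := rfl

theorem pair_offset_left (hjl : j ≠ l) (x : Config N) :
    (pair hjl).offset j x = toC ((2⁻¹ : ℝ) • (x j - x l)) := by
  rw [offset_apply, pair_centre_apply]
  congr 1
  module

theorem pair_offset_right (hjl : j ≠ l) (x : Config N) :
    (pair hjl).offset l x = -(pair hjl).offset j x := by
  rw [pair_offset_left, offset_apply, pair_centre_apply, ← map_neg]
  congr 1
  module

theorem pair_turningPairs (hjl : j ≠ l) : (pair hjl).turningPairs = 1 := by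
  simp [turningPairs, pair, Finset.card_pair hjl]

theorem pair_inertia (hjl : j ≠ l) (x : Config N) :
    (pair hjl).inertia x = ‖x j - x l‖ ^ 2 / 2 := by
  rw [inertia, pair, Finset.sum_pair hjl]
  change ‖(pair hjl).offset j x‖ ^ 2 + ‖(pair hjl).offset l x‖ ^ 2 = _
  rw [pair_offset_right, norm_neg, pair_offset_left, toC.norm_map, norm_smul]
  norm_num
  ring

theorem pair_trace_field (hjl : j ≠ l) :
    LinearMap.trace ℝ (Config N) ((pair hjl).field Complex.I) = 0 := by
  rw [trace_field (c := 2⁻¹), Complex.I_re, mul_zero]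
  intro i hi a
  rw [pair_centre_apply]
  rcases Finset.mem_insert.1 hi with rfl | hi
  · simp [basisVector, hjl.symm]
  · rw [Finset.mem_singleton.1 hi]
    simp [basisVector, hjl]

theorem pair_swap_mem_moving (hjl : j ≠ l) (i : Fin N) :
    Equiv.swap j l i ∈ (pair hjl).moving ↔ i ∈ (pair hjl).moving := by
  by_cases hj : i = j
  · simp [pair, hj]
  · by_cases hl : i = l
    · simp [pair, hl]
    · rw [Equiv.swap_apply_of_ne_of_ne hj hl]

theorem pair_flow_pi (hjl : j ≠ l) (x : Config N) :
    flow ((pair hjl).field Complex.I) Real.pi x = x ∘ Equiv.swap j l := by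
  have hcentre : (pair hjl).centre (x ∘ Equiv.swap j l) = (pair hjl).centre x := by
    simp [pair_centre_apply, add_comm]
  have hoffset (i : Fin N) : (pair hjl).offset i (x ∘ Equiv.swap j l) =
      (pair hjl).offset (Equiv.swap j l i) x := by
    rw [offset_apply, hcentre]
    rfl
  have hexp : Complex.exp (Complex.I * Real.pi) = -1 := by
    rw [mul_comm, Complex.exp_pi_mul_I]
  refine (pair hjl).ext_offset ((centre_flow _ _ _ _).trans hcentre.symm) fun i => ?_
  rw [hoffset]
  by_cases hi : i ∈ (pair hjl).moving
  · rw [offset_flow _ _ hi, hexp, neg_one_mul]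
    rcases Finset.mem_insert.1 hi with rfl | hi
    · rw [Equiv.swap_apply_left, pair_offset_right]
    · rw [Finset.mem_singleton.1 hi, Equiv.swap_apply_right, pair_offset_right, neg_neg]
  · have hne : i ≠ j ∧ i ≠ l := by simpa [pair] using hi
    rw [offset_flow_of_notMem _ _ hi, Equiv.swap_apply_of_ne_of_ne hne.1 hne.2]

/-- The domain of a rotation: the moving particle is closer to the centre than the spectator. -/
def outerPairs : Set (ℂ × ℂ) := {p | ‖p.1‖ < ‖p.2‖}

theorem isOpen_outerPairs : IsOpen outerPairs :=
  isOpen_lt (by fun_prop) (by fun_prop)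

theorem outerPairs_subset_slitPairs : outerPairs ⊆ slitPairs := fun p hp => by
  have hpos : 0 < ‖p.2‖ := (norm_nonneg _).trans_lt hp
  refine ⟨norm_pos_iff.1 hpos, ?_⟩
  rw [sub_eq_add_neg]
  refine Complex.mem_slitPlane_of_norm_lt_one ?_
  rwa [norm_neg, norm_div, div_lt_one hpos]

theorem cexp_I_mul_mem_outerPairs (s : ℝ) (p : ℂ × ℂ) (hp : p ∈ outerPairs) :
    (Complex.exp (Complex.I * s) * p.1, p.2) ∈ outerPairs := by
  rwa [outerPairs, Set.mem_ofPred_eq, norm_mul, mul_comm Complex.I, Complex.norm_exp_ofReal_mul_I,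
    one_mul]

theorem integral_sum_pair (hjl : j ≠ l) (hG : ∀ j, MemLp (G j) 2 volume) :
    ∫ x, ∑ i ∈ {j, l}, ‖G i x‖ ^ 2 = (∫ x, ‖G j x‖ ^ 2) + ∫ x, ‖G l x‖ ^ 2 := by
  simp only [Finset.sum_pair hjl]
  exact integral_add ((hG j).integrable_norm_pow two_ne_zero)
    ((hG l).integrable_norm_pow two_ne_zero)

theorem setLIntegral_pair_region_le (hjl : j ≠ l) (hφ : IsSymmetricL2 φ)
    (hG : ∀ j, MemLp (G j) 2 volume) (hD : ∀ j, IsMagneticDeriv α j φ (G j)) {m : ℝ}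
    (hm0 : 0 < m) (hm : ∀ q : ℤ, m ≤ |α - 2 * q| ^ 2) :
    ∫⁻ x in (pair hjl).region outerPairs, ENNReal.ofReal (‖φ x‖ ^ 2 / ‖x j - x l‖ ^ 2) ≤
      ENNReal.ofReal ((2 * m)⁻¹ * ((∫ x, ‖G j x‖ ^ 2) + ∫ x, ‖G l x‖ ^ 2)) := by
  have hestimate := (pair hjl).setLIntegral_sq_div_inertia_le_of_rotation (α := α)
    hφ hG hD isOpen_outerPairs outerPairs_subset_slitPairs cexp_I_mul_mem_outerPairs
    (pair_trace_field hjl) (σ := Equiv.swap j l) (pair_swap_mem_moving hjl) (pair_flow_pi hjl) hm0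
    (by simpa only [pair_turningPairs, Nat.cast_one, mul_one] using hm)
  have hmoving : ∫ x, ∑ i ∈ (pair hjl).moving, ‖G i x‖ ^ 2 = _ := integral_sum_pair hjl hG
  rw [hmoving] at hestimate
  have hhalf (x : Config N) : ENNReal.ofReal (‖φ x‖ ^ 2 / ‖x j - x l‖ ^ 2) =
      ENNReal.ofReal 2⁻¹ * ENNReal.ofReal (‖φ x‖ ^ 2 / (pair hjl).inertia x) := by
    rw [← ENNReal.ofReal_mul (by norm_num), pair_inertia, div_div_eq_mul_div]
    congr 1
    ring
  simp only [hhalf]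
  rw [lintegral_const_mul' _ _ ENNReal.ofReal_ne_top, mul_inv, mul_assoc,
    ENNReal.ofReal_mul (by norm_num)]
  gcongr

/-- The particles `j` and `l`, moving relative to the particle `k`. -/
noncomputable def triple (hjl : j ≠ l) (hkj : k ≠ j) (hkl : k ≠ l) : Cluster N where
  moving := {j, l}
  pinned := {k}
  centre := ContinuousLinearMap.proj k
  disjoint := by simp [hkj, hkl]
  nontrivial := ⟨j, by simp, l, by simp, hjl⟩
  apply_pinned i hi x := by rw [Finset.mem_singleton.1 hi]; rfl
  centre_motion z x := by simp [hkj, hkl]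

theorem triple_offset (hjl : j ≠ l) (hkj : k ≠ j) (hkl : k ≠ l) (i : Fin N) (x : Config N) :
    (triple hjl hkj hkl).offset i x = toC (x i - x k) := rfl

theorem triple_inertia (hjl : j ≠ l) (hkj : k ≠ j) (hkl : k ≠ l) (x : Config N) :
    (triple hjl hkj hkl).inertia x = ‖x j - x k‖ ^ 2 + ‖x l - x k‖ ^ 2 := by
  simp only [inertia, triple_offset, toC.norm_map]
  exact Finset.sum_pair hjl

theorem triple_trace_field (hjl : j ≠ l) (hkj : k ≠ j) (hkl : k ≠ l) :
    LinearMap.trace ℝ (Config N) ((triple hjl hkj hkl).field 1) = 4 := by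
  have hcentre : ∀ i ∈ (triple hjl hkj hkl).moving, ∀ a,
      (triple hjl hkj hkl).centre (basisVector (i, a)) =
        (0 : ℝ) • EuclideanSpace.single a 1 := by
    intro i hi a
    rw [zero_smul]
    exact Pi.single_eq_of_ne (by rintro rfl; simp [triple, hkj, hkl] at hi) _
  rw [trace_field _ _ hcentre, triple, Finset.card_pair hjl]
  norm_num

/-- The domain of a dilation: the offsets are linearly independent over the reals. -/
def noncollinearPairs : Set (ℂ × ℂ) := {p | p.1.im * p.2.re - p.1.re * p.2.im ≠ 0}

theorem isOpen_noncollinearPairs : IsOpen noncollinearPairs :=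
  isOpen_ne_fun (by fun_prop) (by fun_prop)

theorem noncollinearPairs_subset_slitPairs : noncollinearPairs ⊆ slitPairs := fun p hp => by
  have hne : p.2 ≠ 0 := fun h => hp (by simp [h])
  refine ⟨hne, Or.inr ?_⟩
  rw [Complex.sub_im, Complex.one_im, zero_sub, neg_ne_zero, Complex.div_im, ← sub_div]
  exact div_ne_zero hp (Complex.normSq_pos.2 hne).ne'

theorem cexp_mul_mem_noncollinearPairs (s : ℝ) (p : ℂ × ℂ) (hp : p ∈ noncollinearPairs) :
    (Complex.exp (1 * s) * p.1, p.2) ∈ noncollinearPairs := by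
  have hscale : Real.exp s * (p.1.im * p.2.re - p.1.re * p.2.im) ≠ 0 :=
    mul_ne_zero (Real.exp_pos s).ne' hp
  rw [noncollinearPairs, Set.mem_ofPred_eq, one_mul, ← Complex.ofReal_exp, Complex.im_ofReal_mul,
    Complex.re_ofReal_mul]
  convert hscale using 1
  ring

theorem setLIntegral_triple_region_le (hjl : j ≠ l) (hkj : k ≠ j) (hkl : k ≠ l)
    (hφ : MemLp φ 2 volume) (hG : ∀ j, MemLp (G j) 2 volume)
    (hD : ∀ j, IsMagneticDeriv α j φ (G j)) :
    ∫⁻ x in (triple hjl hkj hkl).region noncollinearPairs,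
        ENNReal.ofReal (‖φ x‖ ^ 2 / (‖x j - x k‖ ^ 2 + ‖x l - x k‖ ^ 2)) ≤
      ENNReal.ofReal ((∫ x, ‖G j x‖ ^ 2) + ∫ x, ‖G l x‖ ^ 2) := by
  have hestimate := (triple hjl hkj hkl).setLIntegral_sq_div_inertia_le_of_dilation hφ hG hD
    isOpen_noncollinearPairs noncollinearPairs_subset_slitPairs cexp_mul_mem_noncollinearPairs
    (by rw [triple_trace_field]; norm_num)
  have hmoving : ∫ x, ∑ i ∈ (triple hjl hkj hkl).moving, ‖G i x‖ ^ 2 = _ :=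
    integral_sum_pair hjl hG
  have hconst : (((4 - 2 : ℝ) / 2) ^ 2)⁻¹ = 1 := by norm_num
  simpa only [triple_trace_field, triple_inertia, hmoving, hconst, one_mul] using hestimate

end Cluster

namespace Cluster

variable {N : ℕ} {j k l : Fin N} {x : Config N}

theorem exists_sq_add_sq_le_of_notMem_pair_region (hjl : j ≠ l) (hx : x ∉ diagonals N)
    (hx_region : x ∉ (pair hjl).region outerPairs) :
    ∃ k, k ≠ j ∧ k ≠ l ∧ ‖x j - x k‖ ^ 2 + ‖x l - x k‖ ^ 2 ≤ ‖x j - x l‖ ^ 2 := by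
  obtain ⟨i, hi, k, hk, hle⟩ : ∃ i ∈ (pair hjl).moving, ∃ k ∈ (pair hjl).spectators,
      ‖(pair hjl).offset k x‖ ≤ ‖(pair hjl).offset i x‖ := by
    by_contra! hlt
    exact hx_region ⟨hx, hlt⟩
  have hkjl : k ≠ j ∧ k ≠ l := by simpa [pair, spectators] using hk
  refine ⟨k, hkjl.1, hkjl.2, ?_⟩
  set z := (pair hjl).offset j x
  set w := (pair hjl).offset k x
  have hl : (pair hjl).offset l x = -z := pair_offset_right hjl x
  have hwz : ‖w‖ ≤ ‖z‖ := by
    rcases Finset.mem_insert.1 hi with rfl | hi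
    · exact hle
    · rwa [Finset.mem_singleton.1 hi, hl, norm_neg] at hle
  simp only [← toC.norm_map (_ - _), ← (pair hjl).offset_sub_offset, hl]
  calc ‖z - w‖ ^ 2 + ‖-z - w‖ ^ 2 = 2 * (‖z‖ ^ 2 + ‖w‖ ^ 2) := by
        rw [← parallelogram_law_with_norm ℝ, ← neg_add', norm_neg, add_comm]
    _ ≤ 2 * (‖z‖ ^ 2 + ‖z‖ ^ 2) := by gcongr
    _ = ‖z - -z‖ ^ 2 := by
        rw [sub_neg_eq_add, ← two_mul z, norm_mul, Complex.norm_two]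
        ring

theorem ae_offset_mem_noncollinearPairs {i m : Fin N} (hik : i ≠ k) (hmk : m ≠ k) (him : i ≠ m) :
    ∀ᵐ x : Config N, (toC (x i - x k), toC (x m - x k)) ∈ noncollinearPairs := by
  refine ae_ne_zero_of_polynomial_on_lines volume (f := fun x : Config N =>
    (toC (x i - x k)).im * (toC (x m - x k)).re - (toC (x i - x k)).re * (toC (x m - x k)).im)
    (by fun_prop) (basisVector (i, 0) + basisVector (m, 1)) fun y => ?_
  set z := toC (y i - y k)
  set w := toC (y m - y k)
  have hk (t : ℝ) : (y + t • (basisVector (i, 0) + basisVector (m, 1))) k = y k := by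
    simp [basisVector, hik.symm, hmk.symm]
  have hz (t : ℝ) : toC ((y + t • (basisVector (i, 0) + basisVector (m, 1))) i -
      (y + t • (basisVector (i, 0) + basisVector (m, 1))) k) = z + t := by
    have hi : (y + t • (basisVector (i, 0) + basisVector (m, 1))) i =
        y i + t • EuclideanSpace.single 0 1 := by
      simp [basisVector, him]
    rw [hi, hk, add_sub_right_comm, map_add, map_smul]
    simp [z, toC_apply]
  have hw (t : ℝ) : toC ((y + t • (basisVector (i, 0) + basisVector (m, 1))) m -
      (y + t • (basisVector (i, 0) + basisVector (m, 1))) k) = w + t * Complex.I := by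
    have hm : (y + t • (basisVector (i, 0) + basisVector (m, 1))) m =
        y m + t • EuclideanSpace.single 1 1 := by
      simp [basisVector, him.symm]
    rw [hm, hk, add_sub_right_comm, map_add, map_smul]
    simp [w, toC_apply]
  have hmonic : (Polynomial.X ^ 2 + (Polynomial.C (z.re + w.im) * Polynomial.X +
      Polynomial.C (z.re * w.im - z.im * w.re))).Monic :=
    Polynomial.monic_X_pow_add Polynomial.degree_linear_lt
  refine ⟨_, neg_ne_zero.2 hmonic.ne_zero, fun t => ?_⟩
  simp only [hz, hw, Complex.add_re, Complex.add_im, Complex.ofReal_re, Complex.ofReal_im,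
    Complex.re_ofReal_mul, Complex.im_ofReal_mul, Complex.I_re, Complex.I_im, Polynomial.eval_neg,
    Polynomial.eval_add, Polynomial.eval_pow, Polynomial.eval_mul, Polynomial.eval_X,
    Polynomial.eval_C]
  ring

theorem ae_mem_triple_region (hjl : j ≠ l) (hkj : k ≠ j) (hkl : k ≠ l) :
    ∀ᵐ x : Config N, x ∈ (triple hjl hkj hkl).region noncollinearPairs := by
  have hpairs : ∀ᵐ x : Config N, ∀ i ∈ (triple hjl hkj hkl).moving,
      ∀ m ∈ (triple hjl hkj hkl).spectators,
        ((triple hjl hkj hkl).offset i x, (triple hjl hkj hkl).offset m x) ∈ noncollinearPairs := by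
    refine ae_all_iff.2 fun i => Filter.eventually_imp_distrib_left.2 fun hi =>
      ae_all_iff.2 fun m => Filter.eventually_imp_distrib_left.2 fun hm => ?_
    simp only [triple, spectators, Finset.mem_compl, Finset.mem_union, Finset.mem_insert,
      Finset.mem_singleton, not_or] at hi hm
    exact ae_offset_mem_noncollinearPairs (by grind) (by grind) (by grind)
  filter_upwards [ae_notMem_diagonals, hpairs] with x hx hx_pairs
  exact ⟨hx, hx_pairs⟩

end Cluster

theorem le_hardyConst (α : ℝ) (q : ℤ) : hardyConst α / 2 ≤ |α - 2 * q| ^ 2 := by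
  rw [hardyConst, mul_div_cancel_left₀ _ two_ne_zero]
  exact ciInf_le ⟨0, Set.forall_mem_range.2 fun q => by positivity⟩ q

theorem hardyConst_pos {α : ℝ} (hα : ∀ q : ℤ, α ≠ 2 * q) : 0 < hardyConst α := by
  set q₀ := round (α / 2)
  have hdist (q : ℤ) : |α - 2 * q| = 2 * |α / 2 - q| := by
    rw [← abs_two, ← abs_mul, abs_two, mul_sub, mul_div_cancel₀ _ two_ne_zero]
  have hpos : 0 < |α - 2 * q₀| ^ 2 := pow_pos (abs_pos.2 (sub_ne_zero.2 (hα q₀))) 2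
  refine mul_pos two_pos (hpos.trans_le (le_ciInf fun q => ?_))
  rw [hdist, hdist]
  gcongr (2 * ?_) ^ 2
  exact round_le (α / 2) q

theorem ne_two_mul_intCast {α : ℝ} (hα : α ∈ Set.Ioo (0 : ℝ) 2) (q : ℤ) : α ≠ 2 * q := by
  rintro rfl
  have hq : (0 : ℝ) < q ∧ (q : ℝ) < 1 := ⟨by linarith [hα.1], by linarith [hα.2]⟩
  norm_cast at hq
  omega

section Hardy

open Cluster

variable {N : ℕ} {α : ℝ} {φ : Config N → ℂ} {G : Fin N → Config N → EuclideanSpace ℂ (Fin 2)}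
  {j k l : Fin N}

theorem lintegral_triple_le (hjl : j ≠ l) (hkj : k ≠ j) (hkl : k ≠ l) (hφ : MemLp φ 2 volume)
    (hG : ∀ j, MemLp (G j) 2 volume) (hD : ∀ j, IsMagneticDeriv α j φ (G j)) :
    ∫⁻ x, ENNReal.ofReal (‖φ x‖ ^ 2 / (‖x j - x k‖ ^ 2 + ‖x l - x k‖ ^ 2)) ≤
      ENNReal.ofReal ((∫ x, ‖G j x‖ ^ 2) + ∫ x, ‖G l x‖ ^ 2) := by
  have hregion := Measure.restrict_eq_self_of_ae_mem (ae_mem_triple_region hjl hkj hkl)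
  simpa only [hregion] using setLIntegral_triple_region_le hjl hkj hkl hφ hG hD

theorem ofReal_sq_div_le_indicator_add_sum (hjl : j ≠ l) (φ : Config N → ℂ) {x : Config N}
    (hx : x ∉ diagonals N) :
    ENNReal.ofReal (‖φ x‖ ^ 2 / ‖x j - x l‖ ^ 2) ≤
      ((pair hjl).region outerPairs).indicator
          (fun x => ENNReal.ofReal (‖φ x‖ ^ 2 / ‖x j - x l‖ ^ 2)) x +
        ∑ k ∈ {j, l}ᶜ, ENNReal.ofReal (‖φ x‖ ^ 2 / (‖x j - x k‖ ^ 2 + ‖x l - x k‖ ^ 2)) := by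
  by_cases hx_region : x ∈ (pair hjl).region outerPairs
  · rw [Set.indicator_of_mem hx_region]
    exact le_self_add
  · obtain ⟨k, hkj, hkl, hobtuse⟩ :=
      exists_sq_add_sq_le_of_notMem_pair_region hjl hx hx_region
    have hne : x j - x k ≠ 0 := sub_ne_zero.2 fun h => hx ⟨j, k, hkj.symm, h⟩
    calc ENNReal.ofReal (‖φ x‖ ^ 2 / ‖x j - x l‖ ^ 2)
        ≤ ENNReal.ofReal (‖φ x‖ ^ 2 / (‖x j - x k‖ ^ 2 + ‖x l - x k‖ ^ 2)) := by gcongr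
      _ ≤ ∑ k ∈ {j, l}ᶜ, ENNReal.ofReal (‖φ x‖ ^ 2 / (‖x j - x k‖ ^ 2 + ‖x l - x k‖ ^ 2)) :=
        Finset.single_le_sum
          (f := fun k => ENNReal.ofReal (‖φ x‖ ^ 2 / (‖x j - x k‖ ^ 2 + ‖x l - x k‖ ^ 2)))
          (fun _ _ => zero_le) (by simp [hkj, hkl])
      _ ≤ _ := le_add_self

theorem cast_card_compl_pair (hjl : j ≠ l) : (({j, l}ᶜ : Finset (Fin N)).card : ℝ) = N - 2 := by
  rw [eq_sub_iff_add_eq', ← Nat.cast_two, ← Finset.card_pair hjl]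
  exact_mod_cast (Finset.card_add_card_compl ({j, l} : Finset (Fin N))).trans (Fintype.card_fin N)

theorem aemeasurable_sq_div (hφ : MemLp φ 2 volume) {f : Config N → ℝ} (hf : Continuous f) :
    AEMeasurable (fun x => ‖φ x‖ ^ 2 / f x) volume :=
  (hφ.1.aemeasurable.norm.pow_const 2).div hf.aemeasurable

theorem lintegral_pair_le (hjl : j ≠ l) (hα : ∀ q : ℤ, α ≠ 2 * q) (hφ : IsSymmetricL2 φ)
    (hG : ∀ j, MemLp (G j) 2 volume) (hD : ∀ j, IsMagneticDeriv α j φ (G j)) :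
    ∫⁻ x, ENNReal.ofReal (‖φ x‖ ^ 2 / ‖x j - x l‖ ^ 2) ≤
      ENNReal.ofReal (((hardyConst α)⁻¹ + ((N : ℝ) - 2)) *
        ((∫ x, ‖G j x‖ ^ 2) + ∫ x, ‖G l x‖ ^ 2)) := by
  have hC : 0 < hardyConst α := hardyConst_pos hα
  have hregion : MeasurableSet ((pair hjl).region outerPairs) :=
    (isOpen_region _ isOpen_outerPairs).measurableSet
  have hmeas {f : Config N → ℝ} (hf : Continuous f) :=
    (aemeasurable_sq_div hφ.memLp hf).ennreal_ofReal
  have hpair := setLIntegral_pair_region_le hjl hφ hG hD (half_pos hC) (le_hardyConst α)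
  rw [mul_div_cancel₀ _ two_ne_zero] at hpair
  set e := (∫ x, ‖G j x‖ ^ 2) + ∫ x, ‖G l x‖ ^ 2
  have he : 0 ≤ e := by positivity
  calc ∫⁻ x, ENNReal.ofReal (‖φ x‖ ^ 2 / ‖x j - x l‖ ^ 2)
      ≤ ∫⁻ x, (((pair hjl).region outerPairs).indicator
            (fun x => ENNReal.ofReal (‖φ x‖ ^ 2 / ‖x j - x l‖ ^ 2)) x +
          ∑ k ∈ {j, l}ᶜ, ENNReal.ofReal (‖φ x‖ ^ 2 / (‖x j - x k‖ ^ 2 + ‖x l - x k‖ ^ 2))) :=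
        lintegral_mono_ae (ae_notMem_diagonals.mono fun x hx =>
          ofReal_sq_div_le_indicator_add_sum hjl φ hx)
    _ = (∫⁻ x in (pair hjl).region outerPairs, ENNReal.ofReal (‖φ x‖ ^ 2 / ‖x j - x l‖ ^ 2)) +
          ∑ k ∈ {j, l}ᶜ,
            ∫⁻ x, ENNReal.ofReal (‖φ x‖ ^ 2 / (‖x j - x k‖ ^ 2 + ‖x l - x k‖ ^ 2)) := by
        rw [lintegral_add_left' ((hmeas (by fun_prop)).indicator hregion),
          lintegral_indicator hregion,
          lintegral_finsetSum' _ fun _ _ => hmeas (by fun_prop)]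
    _ ≤ ENNReal.ofReal ((hardyConst α)⁻¹ * e) + ∑ _k ∈ {j, l}ᶜ, ENNReal.ofReal e := by
        refine add_le_add hpair (Finset.sum_le_sum fun k hk => ?_)
        have hne : k ≠ j ∧ k ≠ l := by simpa using hk
        exact lintegral_triple_le hjl hne.1 hne.2 hφ.memLp hG hD
    _ = _ := by
        rw [Finset.sum_const, nsmul_eq_mul, ← ENNReal.ofReal_natCast,
          ← ENNReal.ofReal_mul (Nat.cast_nonneg _),
          ← ENNReal.ofReal_add (by positivity) (by positivity), cast_card_compl_pair hjl, add_mul]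

theorem inv_hardyConst_add_nonneg (hα : ∀ q : ℤ, α ≠ 2 * q) (hN : 2 ≤ N) :
    0 ≤ (hardyConst α)⁻¹ + ((N : ℝ) - 2) :=
  add_nonneg (inv_pos.2 (hardyConst_pos hα)).le (sub_nonneg.2 (Nat.ofNat_le_cast.2 hN))

theorem integrable_sq_div (hjl : j ≠ l) (hα : ∀ q : ℤ, α ≠ 2 * q) (hφ : IsSymmetricL2 φ)
    (hG : ∀ j, MemLp (G j) 2 volume) (hD : ∀ j, IsMagneticDeriv α j φ (G j)) :
    Integrable (fun x => ‖φ x‖ ^ 2 / ‖x j - x l‖ ^ 2) volume := by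
  refine ⟨(aemeasurable_sq_div hφ.memLp (by fun_prop)).aestronglyMeasurable, ?_⟩
  rw [hasFiniteIntegral_iff_ofReal (.of_forall fun x => by positivity)]
  exact (lintegral_pair_le hjl hα hφ hG hD).trans_lt ENNReal.ofReal_lt_top

theorem integral_sq_div_le (hN : 2 ≤ N) (hjl : j ≠ l) (hα : ∀ q : ℤ, α ≠ 2 * q)
    (hφ : IsSymmetricL2 φ) (hG : ∀ j, MemLp (G j) 2 volume)
    (hD : ∀ j, IsMagneticDeriv α j φ (G j)) :
    ∫ x, ‖φ x‖ ^ 2 / ‖x j - x l‖ ^ 2 ≤ ((hardyConst α)⁻¹ + ((N : ℝ) - 2)) *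
      ((∫ x, ‖G j x‖ ^ 2) + ∫ x, ‖G l x‖ ^ 2) := by
  rw [integral_eq_lintegral_of_nonneg_ae (.of_forall fun x => by positivity)
    (integrable_sq_div hjl hα hφ hG hD).1]
  exact ENNReal.toReal_le_of_le_ofReal
    (mul_nonneg (inv_hardyConst_add_nonneg hα hN) (by positivity))
    (lintegral_pair_le hjl hα hφ hG hD)

theorem sum_Ioi_add (E : Fin N → ℝ) :
    ∑ j, ∑ l ∈ Finset.Ioi j, (E j + E l) = ((N : ℝ) - 1) * ∑ k, E k := by
  have hcomm : ∑ j, ∑ l ∈ Finset.Ioi j, E l = ∑ l, ∑ _j ∈ Finset.Iio l, E l :=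
    Finset.sum_comm' (by simp)
  simp only [Finset.sum_add_distrib, hcomm, Finset.sum_const, Fin.card_Ioi, Fin.card_Iio,
    nsmul_eq_mul]
  rw [← Finset.sum_add_distrib, Finset.mul_sum]
  refine Finset.sum_congr rfl fun i _ => ?_
  have hcard : ((N - 1 - i + i + 1 : ℕ) : ℝ) = N := congrArg Nat.cast (by omega)
  push_cast at hcard
  rw [← add_mul, eq_sub_of_add_eq hcard]

theorem sum_integral_sq_div_le (hN : 2 ≤ N) (hα : ∀ q : ℤ, α ≠ 2 * q) (hφ : IsSymmetricL2 φ)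
    (hG : ∀ j, MemLp (G j) 2 volume) (hD : ∀ j, IsMagneticDeriv α j φ (G j)) :
    ∑ j, ∑ l ∈ Finset.Ioi j, ∫ x, ‖φ x‖ ^ 2 / ‖x j - x l‖ ^ 2 ≤
      ((hardyConst α)⁻¹ + ((N : ℝ) - 2)) * (((N : ℝ) - 1) * ∑ k, ∫ x, ‖G k x‖ ^ 2) := by
  rw [← sum_Ioi_add, Finset.mul_sum]
  simp only [Finset.mul_sum]
  exact Finset.sum_le_sum fun j _ => Finset.sum_le_sum fun l hl =>
    integral_sq_div_le hN (Finset.mem_Ioi.1 hl).ne hα hφ hG hD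

theorem two_mul_div_le_div {C : ℝ} (hC : 0 < C) (hN : 2 ≤ N) :
    2 * C / (((N : ℝ) - 1) * (2 + 3 * ((N : ℝ) - 2) * C)) ≤
      C / (((N : ℝ) - 1) * (1 + ((N : ℝ) - 2) * C)) := by
  have hN₁ : 0 < (N : ℝ) - 1 := by linarith [Nat.ofNat_le_cast (α := ℝ).2 hN]
  have hN₂ : 0 ≤ (N : ℝ) - 2 := sub_nonneg.2 (Nat.ofNat_le_cast.2 hN)
  rw [← mul_div_mul_left C _ two_ne_zero, mul_left_comm]
  gcongr
  nlinarith [mul_nonneg hN₂ hC.le]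

end Hardy

end Anyon

theorem theorem2p3_general (N : ℕ) (hN : 2 ≤ N) (α : ℝ) (hα : ∀ q : ℤ, α ≠ 2 * q)
    (φ : Anyon.Config N → ℂ) (hφ : Anyon.IsSymmetricL2 φ)
    (Dφ : Fin N → Anyon.Config N → EuclideanSpace ℂ (Fin 2))
    (hD : ∀ j, Anyon.IsMagneticDeriv α j φ (Dφ j))
    (hDL2 : ∀ j, MemLp (Dφ j) 2 volume) :
    (∀ j l : Fin N, j < l → Integrable (fun x => ‖φ x‖ ^ 2 / ‖x j - x l‖ ^ 2) volume) ∧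
    Anyon.hardyConst α / (((N : ℝ) - 1) * (1 + ((N : ℝ) - 2) * Anyon.hardyConst α)) *
        ∑ j : Fin N, ∑ l ∈ Finset.Ioi j, ∫ x, ‖φ x‖ ^ 2 / ‖x j - x l‖ ^ 2 ≤
      ∑ k : Fin N, ∫ x, ‖Dφ k x‖ ^ 2 := by
  refine ⟨fun j l hjl => Anyon.integrable_sq_div hjl.ne hα hφ hDL2 hD, ?_⟩
  have hC : 0 < Anyon.hardyConst α := Anyon.hardyConst_pos hα
  have hN₁ : 0 < (N : ℝ) - 1 := sub_pos.2 (Nat.one_lt_cast.2 hN)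
  have hN₂ : 0 ≤ (N : ℝ) - 2 := sub_nonneg.2 (Nat.ofNat_le_cast.2 hN)
  rw [div_mul_eq_mul_div, div_le_iff₀ (by positivity)]
  calc _ ≤ Anyon.hardyConst α * (((Anyon.hardyConst α)⁻¹ + ((N : ℝ) - 2)) *
          (((N : ℝ) - 1) * ∑ k, ∫ x, ‖Dφ k x‖ ^ 2)) :=
        mul_le_mul_of_nonneg_left (Anyon.sum_integral_sq_div_le hN hα hφ hDL2 hD) hC.le
    _ = _ := by field_simp

theorem theorem2p3 (N : ℕ) (hN : 2 ≤ N) (α : ℝ) (hα : α ∈ Set.Ioo (0 : ℝ) 2)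
    (φ : Anyon.Config N → ℂ) (hφ : Anyon.IsSymmetricL2 φ)
    (Dφ : Fin N → Anyon.Config N → EuclideanSpace ℂ (Fin 2))
    (hD : ∀ j, Anyon.IsMagneticDeriv α j φ (Dφ j))
    (hDL2 : ∀ j, MemLp (Dφ j) 2 volume) :
    (∀ j l : Fin N, j < l → Integrable (fun x => ‖φ x‖ ^ 2 / ‖x j - x l‖ ^ 2) volume) ∧
    2 * Anyon.hardyConst α /
          (((N : ℝ) - 1) * (2 + 3 * ((N : ℝ) - 2) * Anyon.hardyConst α)) *
        ∑ j : Fin N, ∑ l ∈ Finset.Ioi j, ∫ x, ‖φ x‖ ^ 2 / ‖x j - x l‖ ^ 2 ≤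
      ∑ k : Fin N, ∫ x, ‖Dφ k x‖ ^ 2 := by
  have hα' : ∀ q : ℤ, α ≠ 2 * q := Anyon.ne_two_mul_intCast hα
  refine (theorem2p3_general N hN α hα' φ hφ Dφ hD hDL2).imp_right (le_trans ?_)
  gcongr ?_ * _
  exact Anyon.two_mul_div_le_div (Anyon.hardyConst_pos hα') hN
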